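/- Let $d\ge 1$, $0<\delta<\rho_0$, and let $f:\mathbb R\to[0,\infty)$ be Lipschitz and even, with $\operatorname{supp} f=[-\rho_0,\rho_0]$, constant on $[-\delta,\delta]$ and nonincreasing on $[0,\infty)$. For measurable $F\subseteq\mathbb R^d$ and $s>0$ put $$\mathcal E_s(F)=\frac1{2s}\int_{\mathbb R^d}\Big(\operatorname*{ess\,sup}_{B(x,s)}\chi_F-\operatorname*{ess\,inf}_{B(x,s)}\chi_F\Big)\,dx,\qquad \mathcal E^f(F)=\int_0^{\rho_0}(-2sf'(s))\,\mathcal E_s(F)\,ds .$$ For a bounded open set $E\subset\mathbb R^d$ of class $C^2$ with outer unit normal $\nu_E$, for $x\in\partial E$ and $s>0$, let $$\kappa_s^+(E,x)=\begin{cases}\frac1{2s}\det(I+s\nabla\nu_E(x)) & \text{if }\operatorname{dist}(x+s\nu_E(x),E)=s,\\ 0&\text{otherwise,}\end{cases}$$ $$\kappa_s^-(E,x)=\begin{cases}-\frac1{2s}\det(I-s\nabla\nu_E(x)) & \text{if }\operatorname{dist}(x-s\nu_E(x),\mathbb R^d\setminus E)=s,\\ 0&\text{otherwise,}\end{cases}$$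 where $\nabla\nu_E(x)$ is the tangential derivative of $\nu_E$ along $\partial E$ at $x$, extended by $0$ in the direction $\nu_E(x)$, and let $$\kappa_f(E,x)=\int_0^{\rho_0}(-2sf'(s))\,\kappa_s^+(E,x)\,ds+\int_0^{\rho_0}(-2sf'(s))\,\kappa_s^-(E,x)\,ds .$$ **Theorem.** Let $E\subset\mathbb R^d$ be a bounded open set of class $C^2$, let $\varphi\in C^2(\partial E;\mathbb R)$, and let $(\Phi_\varepsilon)_{\varepsilon\in\mathbb R}$ be a family of $C^1$ diffeomorphisms of $\mathbb R^d$ such that, for all $\varepsilon$ sufficiently close to $0$, $\Phi_\varepsilon(x)=x+\varepsilon\varphi(x)\nu_E(x)$ for every $x\in\partial E$. Then the integrals defining $\kappa_f(E,x)$ converge absolutely for every $x\in\partial E$, the function $\kappa_f(E,\cdot)\,\varphi$ is integrable on $\partial E$ with respect to $\mathcal H^{d-1}$, the energies $\mathcal E^f(\Phi_\varepsilon(E))$ are finite, the function $\varepsilon\mapsto\mathcal E^f(\Phi_\varepsilon(E))$ is differentiable at $\varepsilon=0$, and $$\frac{d}{d\varepsilon}\mathcal E^f(\Phi_\varepsilon(E))\Big|_{\varepsilon=0}=\int_{\partial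 E}\kappa_f(E,x)\,\varphi(x)\,d\mathcal H^{d-1}(x).$$ -/

import Mathlib

open MeasureTheory Metric Set Filter Topology
open scoped Manifold ENNReal

/-- The Euclidean space `ℝ^d`. -/
abbrev Euc (d : ℕ) := EuclideanSpace ℝ (Fin d)

noncomputable section

/-! ### The energies -/

/-- The essential oscillation `ess sup_A u - ess inf_A u` with respect to Lebesgue measure,
for an essentially bounded function `u`. -/
def essOsc {d : ℕ} (A : Set (Euc d)) (u : Euc d → ℝ) : ℝ :=
  essSup u (volume.restrict A) - essInf u (volume.restrict A)

/-- `ℰ_ρ(E) = (1 / 2ρ) ∫ osc_{B(x,ρ)}(χ_E) dx`, with values in `[0, ∞]`. -/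
def energyAt {d : ℕ} (ρ : ℝ) (E : Set (Euc d)) : ℝ≥0∞ :=
  ENNReal.ofReal (1 / (2 * ρ)) *
    ∫⁻ x, ENNReal.ofReal (essOsc (ball x ρ) (E.indicator (fun _ => (1 : ℝ))))

/-- The assumptions on the averaging profile `f`: a nonnegative, even Lipschitz function with
support `[-ρ₀, ρ₀]`, constant on `[-δ, δ]` and nonincreasing on `[0, ∞)`, where `0 < δ < ρ₀`. -/
structure IsProfile (f : ℝ → ℝ) (ρ₀ δ : ℝ) : Prop where
  delta_pos : 0 < δ
  delta_lt : δ < ρ₀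
  nonneg : ∀ s, 0 ≤ f s
  lipschitz : ∃ K, LipschitzWith K f
  even : ∀ s, f (-s) = f s
  support : tsupport f = Icc (-ρ₀) ρ₀
  const : ∀ s ∈ Icc (-δ) δ, f s = f 0
  antitone : AntitoneOn f (Ici 0)

/-- `ℰ^f(E) = ∫_0^{ρ₀} (-2 s f'(s)) ℰ_s(E) ds`, with values in `[0, ∞]`; the weight
`-2 s f'(s)` is nonnegative because `f` is nonincreasing on `[0, ∞)`. -/
def smoothedEnergy {d : ℕ} (f : ℝ → ℝ) (ρ₀ : ℝ) (E : Set (Euc d)) : ℝ≥0∞ :=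
  ∫⁻ s in Ioc 0 ρ₀, ENNReal.ofReal (-2 * s * deriv f s) * energyAt s E

/-! ### Sets of class `C²`, functions of class `C²` on the boundary, outer normal -/

/-- `g` is a `C²` defining function of `E` near the boundary point `x`: near `x` the set `E` is
`{g < 0}`, and the gradient of `g` at `x` does not vanish. -/
structure IsC2DefiningAt {d : ℕ} (E : Set (Euc d)) (x : Euc d) (g : Euc d → ℝ) : Prop where
  contDiffAt : ContDiffAt ℝ 2 g x
  eq_zero : g x = 0
  gradient_ne_zero : gradient g x ≠ 0
  mem_iff : ∀ᶠ y in 𝓝 x, (y ∈ E ↔ g y < 0)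

/-- `E` is a set of class `C²` (it lies locally on one side of its `C²` boundary). -/
def IsC2Set {d : ℕ} (E : Set (Euc d)) : Prop :=
  ∀ x ∈ frontier E, ∃ g : Euc d → ℝ, IsC2DefiningAt E x g

/-- `φ` is of class `C²` on `∂E`: near each point of `∂E` it is the restriction to `∂E` of a
`C²` function of the ambient space. The values of `φ` off `∂E` play no role. -/
def IsC2OnFrontier {d : ℕ} (E : Set (Euc d)) (φ : Euc d → ℝ) : Prop :=
  ∀ x ∈ frontier E, ∃ ψ : Euc d → ℝ, ContDiffAt ℝ 2 ψ x ∧ ∀ᶠ y in 𝓝[frontier E] x, φ y = ψ y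

open Classical in
/-- The outer unit normal `ν_E(x) = ∇g(x) / |∇g(x)|`, where `g` is any local defining function
(the quotient does not depend on it). It is `0` where there is no defining function. -/
def outerNormal {d : ℕ} (E : Set (Euc d)) (x : Euc d) : Euc d :=
  if h : ∃ g : Euc d → ℝ, IsC2DefiningAt E x g then
    ‖gradient h.choose x‖⁻¹ • gradient h.choose x
  else 0

/-- The orthogonal projection `v ↦ v - ⟨ν, v⟩ ν` onto the tangent space of `∂E` at `x`. -/
def tangentProj {d : ℕ} (E : Set (Euc d)) (x : Euc d) : Euc d →L[ℝ] Euc d :=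
  ContinuousLinearMap.id ℝ (Euc d) -
    (innerSL ℝ (outerNormal E x)).smulRight (outerNormal E x)

/-- `∇ν_E(x)`: the derivative of `ν_E` along `∂E` on tangent vectors, and `0` on the normal
direction (this is the derivative at `x` of `ν_E` extended to be constant along normals). The
derivative within `∂E` is determined on the tangent space, so the composition is well defined. -/
def gradNormal {d : ℕ} (E : Set (Euc d)) (x : Euc d) : Euc d →L[ℝ] Euc d :=
  (fderivWithin ℝ (outerNormal E) (frontier E) x).comp (tangentProj E x)

/-! ### The non-local curvatures -/

open Classical in
/-- `κ⁺_ρ(E, x)`. -/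
def curvPlus {d : ℕ} (ρ : ℝ) (E : Set (Euc d)) (x : Euc d) : ℝ :=
  if infDist (x + ρ • outerNormal E x) E = ρ then
    1 / (2 * ρ) * (ContinuousLinearMap.id ℝ (Euc d) + ρ • gradNormal E x).det
  else 0

open Classical in
/-- `κ⁻_ρ(E, x)`. -/
def curvMinus {d : ℕ} (ρ : ℝ) (E : Set (Euc d)) (x : Euc d) : ℝ :=
  if infDist (x - ρ • outerNormal E x) Eᶜ = ρ then
    -(1 / (2 * ρ) * (ContinuousLinearMap.id ℝ (Euc d) - ρ • gradNormal E x).det)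
  else 0

/-- `κ_f(E, x) = ∫_0^{ρ₀} (-2 s f'(s)) (κ⁺_s(E, x) + κ⁻_s(E, x)) ds`. -/
def curvSmoothed {d : ℕ} (f : ℝ → ℝ) (ρ₀ : ℝ) (E : Set (Euc d)) (x : Euc d) : ℝ :=
  (∫ s in (0 : ℝ)..ρ₀, (-2 * s * deriv f s) * curvPlus s E x) +
    ∫ s in (0 : ℝ)..ρ₀, (-2 * s * deriv f s) * curvMinus s E x

end

/-! The smoothed energy is an integral of the profile of the distance to the boundary. If F is open
and its boundary lies in the closure of the interior of the complement, the essential oscillation of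
χ_F on B(x,s) is 1 exactly when the ball meets ∂F, and 0 otherwise. The factor 2s cancels, and
integrating -f'(s) over s > dist(y,∂F) gives ℰ^f(F) = ∫ f(dist(y,∂F)) dy (`smoothedEnergy_eq`).
Homeomorphisms preserve these topological conditions, and for small ε the boundary of Φ_ε(E) is the
normal graph of εφ. It remains to differentiate ε ↦ ∫ f(dist(y, graph of εφ)) dy.

Every y has the form x + sν(x) with x a nearest boundary point, |s| being the distance. For almost
every y the pair (x,s) can be prolonged to (x,cs) with c > 1 without losing contact. Then x is the
only nearest point, the squared distance grows quadratically away from it, and a Danskin argument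
gives the derivative -sign(s)φ(x) of the distance (`IsC2Set.hasDerivAt_infDist`). Since f is even, f
of the distance has derivative -f'(s)φ(x) on both sides of ∂E. The distance is Lipschitz in ε
uniformly in y, so dominated convergence applies.

Finally the integral is transported to the normal coordinates (x,s), whose Jacobian is det(I +
s∇ν(x)) (`IsC2Set.volume_image_eq`). This determinant is nonnegative on the contact set by second
order minimality (`IsC2Set.det_nonneg`). By Fubini, the slice over x is κ_f(E,x)φ(x): the part s > 0
is κ⁺, the part s < 0 is κ⁻, whose minus sign comes from f' being odd.

The change of variables rests on linearization. Near (x,s₀) the normal coordinates are compared with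
tangential projection plus normal height. That map takes surface measure times length to volume up
to a factor arbitrarily close to 1, and the remaining map is nearly linear with derivative I +
s₀∇ν(x). A countable partition makes the local estimates global. -/

open scoped InnerProductSpace NNReal

/-! ### The outer unit normal and the tangent directions of the boundary. -/

section Normal

variable {d : ℕ} {E : Set (Euc d)} {x : Euc d} {g : Euc d → ℝ}

theorem IsC2DefiningAt.hasFDerivAt (h : IsC2DefiningAt E x g) :
    HasFDerivAt g (InnerProductSpace.toDual ℝ (Euc d) (gradient g x)) x :=
  (h.contDiffAt.differentiableAt (by norm_num)).hasGradientAt.hasFDerivAt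

theorem IsC2DefiningAt.hasDerivAt_line (h : IsC2DefiningAt E x g) (w : Euc d) :
    HasDerivAt (fun t : ℝ => g (x + t • w)) ⟪gradient g x, w⟫_ℝ 0 := by
  have h1 : HasDerivAt (fun t : ℝ => x + t • w) w 0 := by
    simpa using ((hasDerivAt_id (0 : ℝ)).smul_const w).const_add x
  have h2 : HasFDerivAt g (InnerProductSpace.toDual ℝ (Euc d) (gradient g x))
      (x + (0 : ℝ) • w) := by simpa using h.hasFDerivAt
  exact h2.comp_hasDerivAt (0 : ℝ) h1

theorem tendsto_line_nhdsGT (x w : Euc d) :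
    Tendsto (fun t : ℝ => x + t • w) (𝓝[>] 0) (𝓝 x) := by
  have : ContinuousAt (fun t : ℝ => x + t • w) 0 := by fun_prop
  have := this.tendsto
  simp only [zero_smul, add_zero] at this
  exact this.mono_left nhdsWithin_le_nhds

theorem IsC2DefiningAt.eventually_neg (h : IsC2DefiningAt E x g) {w : Euc d}
    (hw : ⟪gradient g x, w⟫_ℝ < 0) : ∀ᶠ t : ℝ in 𝓝[>] 0, g (x + t • w) < 0 := by
  have := (h.hasDerivAt_line w).hasDerivWithinAt (s := Ioi 0)
  filter_upwards [this.limsup_slope_le' (by simp) hw, self_mem_nhdsWithin] with t ht ht0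
  simp only [slope, zero_smul, add_zero, h.eq_zero, sub_zero, vsub_eq_sub, smul_eq_mul] at ht
  have h0 : (0 : ℝ) < t := ht0
  by_contra! hc
  have : 0 ≤ t⁻¹ * g (x + t • w) := by positivity
  linarith

theorem IsC2DefiningAt.eventually_pos (h : IsC2DefiningAt E x g) {w : Euc d}
    (hw : 0 < ⟪gradient g x, w⟫_ℝ) : ∀ᶠ t : ℝ in 𝓝[>] 0, 0 < g (x + t • w) := by
  have := (h.hasDerivAt_line w).neg.hasDerivWithinAt (s := Ioi 0)
  filter_upwards [this.limsup_slope_le' (by simp) (neg_neg_of_pos hw), self_mem_nhdsWithin]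
    with t ht ht0
  simp only [slope, Pi.neg_apply, zero_smul, add_zero, h.eq_zero, neg_zero, sub_zero, vsub_eq_sub,
    smul_eq_mul, mul_neg, Left.neg_neg_iff] at ht
  have h0 : (0 : ℝ) < t := ht0
  by_contra! hc
  have : t⁻¹ * g (x + t • w) ≤ 0 := mul_nonpos_of_nonneg_of_nonpos (by positivity) hc
  linarith

theorem IsC2DefiningAt.eventually_mem (h : IsC2DefiningAt E x g) {w : Euc d}
    (hw : ⟪gradient g x, w⟫_ℝ < 0) : ∀ᶠ t : ℝ in 𝓝[>] 0, x + t • w ∈ E := by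
  filter_upwards [h.eventually_neg hw, (tendsto_line_nhdsGT x w).eventually h.mem_iff] with t h1 h2
  exact h2.2 h1

theorem IsC2DefiningAt.eventually_mem_interior_compl (h : IsC2DefiningAt E x g) {w : Euc d}
    (hw : 0 < ⟪gradient g x, w⟫_ℝ) : ∀ᶠ t : ℝ in 𝓝[>] 0, x + t • w ∈ interior Eᶜ := by
  have hc : ∀ᶠ y in 𝓝 x, ContinuousAt g y :=
    (h.contDiffAt.eventually (by simp)).mono fun y hy => hy.continuousAt
  filter_upwards [h.eventually_pos hw,
    (tendsto_line_nhdsGT x w).eventually h.mem_iff.eventually_nhds,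
    (tendsto_line_nhdsGT x w).eventually hc] with t h1 h2 h3
  rw [mem_interior_iff_mem_nhds]
  filter_upwards [h2, h3.eventually (lt_mem_nhds h1)] with y hy hy'
  rw [mem_compl_iff, hy]
  exact hy'.le.not_gt

theorem IsC2DefiningAt.mem_frontier (h : IsC2DefiningAt E x g) : x ∈ frontier E := by
  have hp : 0 < ⟪gradient g x, gradient g x⟫_ℝ := by
    rw [real_inner_self_eq_norm_sq]; have := norm_pos_iff.2 h.gradient_ne_zero; positivity
  rw [frontier_eq_closure_inter_closure]
  refine ⟨mem_closure_of_tendsto (tendsto_line_nhdsGT x (-gradient g x))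
    (h.eventually_mem (by rw [inner_neg_right]; linarith)),
    mem_closure_of_tendsto (tendsto_line_nhdsGT x (gradient g x))
    ((h.eventually_mem_interior_compl hp).mono fun t ht => interior_subset ht)⟩

/-- If the unit gradients u and u' differed, then ⟨u,u'⟩ < 1, and the direction u' - u would point
into E according to g and out of E according to g'. -/
theorem IsC2DefiningAt.normalized_eq {g' : Euc d → ℝ} (h : IsC2DefiningAt E x g)
    (h' : IsC2DefiningAt E x g') :
    ‖gradient g x‖⁻¹ • gradient g x = ‖gradient g' x‖⁻¹ • gradient g' x := by
  have hn := norm_pos_iff.2 h.gradient_ne_zero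
  have hn' := norm_pos_iff.2 h'.gradient_ne_zero
  set u := ‖gradient g x‖⁻¹ • gradient g x with hu
  set u' := ‖gradient g' x‖⁻¹ • gradient g' x with hu'
  have h1 : ‖u‖ = 1 := by rw [hu, norm_smul, norm_inv, norm_norm]; field_simp
  have h1' : ‖u'‖ = 1 := by rw [hu', norm_smul, norm_inv, norm_norm]; field_simp
  have e : gradient g x = ‖gradient g x‖ • u := by rw [hu, smul_inv_smul₀ hn.ne']
  have e' : gradient g' x = ‖gradient g' x‖ • u' := by rw [hu', smul_inv_smul₀ hn'.ne']
  by_contra hne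
  have hlt : ⟪u, u'⟫_ℝ < 1 := inner_lt_one_iff_real_of_norm_eq_one h1 h1' |>.2 hne
  have a1 : ⟪gradient g x, u' - u⟫_ℝ < 0 := by
    rw [e, inner_smul_left, inner_sub_right, real_inner_self_eq_norm_sq, h1]
    simp only [conj_trivial]
    nlinarith
  have a2 : 0 < ⟪gradient g' x, u' - u⟫_ℝ := by
    rw [e', inner_smul_left, inner_sub_right, real_inner_self_eq_norm_sq, h1', real_inner_comm]
    simp only [conj_trivial]
    nlinarith
  obtain ⟨t, ht, ht'⟩ := ((h.eventually_mem a1).and (h'.eventually_mem_interior_compl a2)).exists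
  exact interior_subset ht' ht

theorem IsC2DefiningAt.outerNormal_eq (h : IsC2DefiningAt E x g) :
    outerNormal E x = ‖gradient g x‖⁻¹ • gradient g x := by
  have hex : ∃ g : Euc d → ℝ, IsC2DefiningAt E x g := ⟨g, h⟩
  rw [outerNormal, dif_pos hex]
  exact hex.choose_spec.normalized_eq h

theorem IsC2DefiningAt.norm_outerNormal (h : IsC2DefiningAt E x g) : ‖outerNormal E x‖ = 1 := by
  have hn := norm_pos_iff.2 h.gradient_ne_zero
  rw [h.outerNormal_eq, norm_smul, norm_inv, norm_norm]; field_simp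

theorem IsC2DefiningAt.gradient_eq (h : IsC2DefiningAt E x g) :
    gradient g x = ‖gradient g x‖ • outerNormal E x := by
  rw [h.outerNormal_eq, smul_inv_smul₀ (norm_ne_zero_iff.2 h.gradient_ne_zero)]

theorem IsC2DefiningAt.inner_gradient (h : IsC2DefiningAt E x g) (w : Euc d) :
    ⟪gradient g x, w⟫_ℝ = ‖gradient g x‖ * ⟪outerNormal E x, w⟫_ℝ := by
  conv_lhs => rw [h.gradient_eq]
  rw [real_inner_smul_left]

theorem IsC2Set.norm_outerNormal (hE : IsC2Set E) (hx : x ∈ frontier E) :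
    ‖outerNormal E x‖ = 1 := by
  obtain ⟨g, hg⟩ := hE x hx
  exact hg.norm_outerNormal

theorem outerNormal_of_notMem_frontier (hx : x ∉ frontier E) : outerNormal E x = 0 := by
  rw [outerNormal, dif_neg]
  rintro ⟨g, hg⟩
  exact hx hg.mem_frontier

theorem IsC2Set.eventually_mem (hE : IsC2Set E) (hx : x ∈ frontier E) {w : Euc d}
    (hw : ⟪outerNormal E x, w⟫_ℝ < 0) : ∀ᶠ t : ℝ in 𝓝[>] 0, x + t • w ∈ E := by
  obtain ⟨g, hg⟩ := hE x hx
  refine hg.eventually_mem ?_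
  rw [hg.inner_gradient]
  exact mul_neg_of_pos_of_neg (norm_pos_iff.2 hg.gradient_ne_zero) hw

theorem IsC2Set.eventually_mem_interior_compl (hE : IsC2Set E) (hx : x ∈ frontier E) {w : Euc d}
    (hw : 0 < ⟪outerNormal E x, w⟫_ℝ) : ∀ᶠ t : ℝ in 𝓝[>] 0, x + t • w ∈ interior Eᶜ := by
  obtain ⟨g, hg⟩ := hE x hx
  refine hg.eventually_mem_interior_compl ?_
  rw [hg.inner_gradient]
  exact mul_pos (norm_pos_iff.2 hg.gradient_ne_zero) hw

theorem IsC2Set.frontier_subset_closure_interior_compl (hE : IsC2Set E) :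
    frontier E ⊆ closure (interior Eᶜ) := by
  intro x hx
  refine mem_closure_of_tendsto (tendsto_line_nhdsGT x (outerNormal E x))
    (hE.eventually_mem_interior_compl hx ?_)
  rw [real_inner_self_eq_norm_sq, hE.norm_outerNormal hx]; norm_num

theorem exists_mem_segment_frontier {a b : Euc d} (ha : a ∈ E) (hb : b ∉ E) :
    ∃ c ∈ segment ℝ a b, c ∈ frontier E := by
  by_contra! hc
  have hpre : IsPreconnected (segment ℝ a b) := (convex_segment a b).isPreconnected
  have := isPreconnected_iff_subset_of_disjoint.1 hpre (interior E) (interior Eᶜ)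
    isOpen_interior isOpen_interior ?_ ?_
  · rcases this with h | h
    · exact hb (interior_subset (h (right_mem_segment ℝ a b)))
    · exact interior_subset (h (left_mem_segment ℝ a b)) ha
  · intro c hcs
    have := hc c hcs
    rw [frontier_eq_closure_inter_closure, mem_inter_iff, not_and_or] at this
    rcases this with h | h
    · right; rwa [interior_compl]
    · left; rwa [closure_compl, mem_compl_iff, not_not] at h
  · rw [interior_compl]
    ext y
    simp only [mem_inter_iff, mem_compl_iff, mem_empty_iff_false, iff_false, not_and, not_not]
    exact fun _ hy => subset_closure (interior_subset hy)

/-- Every vector orthogonal to the normal is the limit of difference quotients along the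
boundary. -/
theorem IsC2Set.exists_seq_tangent (hE : IsC2Set E) (hx : x ∈ frontier E) {v : Euc d}
    (hv : ⟪outerNormal E x, v⟫_ℝ = 0) :
    ∃ (t : ℕ → ℝ) (w : ℕ → Euc d), (∀ n, 0 < t n) ∧ Tendsto t atTop (𝓝 0) ∧
      Tendsto w atTop (𝓝 v) ∧ ∀ n, x + t n • w n ∈ frontier E := by
  have hn := hE.norm_outerNormal hx
  have key : ∀ n : ℕ, ∃ t : ℝ, ∃ w : Euc d, 0 < t ∧ t < 1 / ((n : ℝ) + 1) ∧
      ‖w - v‖ ≤ 1 / ((n : ℝ) + 1) ∧ x + t • w ∈ frontier E := by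
    intro n
    set η : ℝ := 1 / ((n : ℝ) + 1) with hη
    have hη0 : 0 < η := by positivity
    -- Tilting v by η towards each side yields a short segment parallel to the normal with one end
    -- in E and the other outside. It crosses the boundary at some x + t w with ‖w - v‖ ≤ η.
    have e1 := hE.eventually_mem hx (w := v - η • outerNormal E x) (by
      rw [inner_sub_right, inner_smul_right, hv, real_inner_self_eq_norm_sq, hn]; linarith)
    have e2 := hE.eventually_mem_interior_compl hx (w := v + η • outerNormal E x) (by
      rw [inner_add_right, inner_smul_right, hv, real_inner_self_eq_norm_sq, hn]; linarith)
    obtain ⟨t, ⟨⟨h1, h2⟩, h3⟩, h4⟩ := (((e1.and e2).and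
      (Ioo_mem_nhdsGT hη0)).and self_mem_nhdsWithin).exists
    have h0 : 0 < t := h3.1
    obtain ⟨c, hc, hcf⟩ := exists_mem_segment_frontier h1 (fun h => interior_subset h2 h)
    obtain ⟨a, b, ha, hb, hab, rfl⟩ := hc
    refine ⟨t, v + ((b - a) * η) • outerNormal E x, h0, h3.2, ?_, ?_⟩
    · rw [add_sub_cancel_left, norm_smul, hn, mul_one, Real.norm_eq_abs, abs_mul, abs_of_pos hη0]
      have : |b - a| ≤ 1 := by rw [abs_le]; constructor <;> linarith
      nlinarith
    · convert hcf using 1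
      have : a = 1 - b := by linarith
      subst this
      module
  choose t w h0 h1 h2 h3 using key
  have hlim : Tendsto (fun n : ℕ => 1 / ((n : ℝ) + 1)) atTop (𝓝 0) :=
    tendsto_one_div_add_atTop_nhds_zero_nat
  refine ⟨t, w, h0, squeeze_zero (fun n => (h0 n).le) (fun n => (h1 n).le) hlim, ?_, h3⟩
  rw [tendsto_iff_norm_sub_tendsto_zero]
  exact squeeze_zero (fun n => norm_nonneg _) h2 hlim

/-- This makes derivatives within the boundary unique on tangent vectors, so ∇ν can be computed from
any differentiable extension of the normal. -/
theorem IsC2Set.mem_tangentConeAt (hE : IsC2Set E) (hx : x ∈ frontier E) {v : Euc d}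
    (hv : ⟪outerNormal E x, v⟫_ℝ = 0) : v ∈ tangentConeAt ℝ (frontier E) x := by
  obtain ⟨t, w, h0, h1, h2, h3⟩ := hE.exists_seq_tangent hx hv
  refine mem_tangentConeAt_of_seq atTop (fun n => (t n)⁻¹) (fun n => t n • w n) ?_
    (Eventually.of_forall h3) ?_
  · simpa using h1.smul h2
  · refine h2.congr fun n => ?_
    rw [inv_smul_smul₀ (h0 n).ne']

theorem inner_tangentProj (hn : ‖outerNormal E x‖ = 1) (v : Euc d) :
    ⟪outerNormal E x, tangentProj E x v⟫_ℝ = 0 := by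
  simp [tangentProj, inner_sub_right, inner_smul_right, hn]

theorem tangentProj_apply (v : Euc d) :
    tangentProj E x v = v - ⟪outerNormal E x, v⟫_ℝ • outerNormal E x := by
  simp [tangentProj]

theorem tangentProj_of_inner_eq_zero {v : Euc d} (hv : ⟪outerNormal E x, v⟫_ℝ = 0) :
    tangentProj E x v = v := by
  simp [tangentProj_apply, hv]

end Normal

/-! ### First and second order geometry of the boundary near a point. -/

section NormalField

variable {d : ℕ} {E : Set (Euc d)} {x : Euc d} {g : Euc d → ℝ}

theorem ContDiffAt.gradient {n m : WithTop ℕ∞} (h : ContDiffAt ℝ n g x) (hm : m + 1 ≤ n) :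
    ContDiffAt ℝ m (gradient g) x :=
  ((InnerProductSpace.toDual ℝ (Euc d)).symm.contDiff.contDiffAt).comp x (h.fderiv_right hm)

theorem IsC2DefiningAt.contDiffAt_gradient (h : IsC2DefiningAt E x g) :
    ContDiffAt ℝ 1 (_root_.gradient g) x :=
  h.contDiffAt.gradient (by norm_num)

/-- At a nearby boundary point y, g y > 0 would keep y away from the closure of E, while g y < 0
would put y in E, which is open and so misses its frontier. -/
theorem IsC2DefiningAt.eventually_isC2DefiningAt (hEo : IsOpen E) (h : IsC2DefiningAt E x g) :
    ∀ᶠ y in 𝓝[frontier E] x, IsC2DefiningAt E y g := by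
  have h1 : ∀ᶠ y in 𝓝 x, ContDiffAt ℝ 2 g y := h.contDiffAt.eventually (by simp)
  have h2 : ∀ᶠ y in 𝓝 x, _root_.gradient g y ≠ 0 :=
    h.contDiffAt_gradient.continuousAt.eventually_ne h.gradient_ne_zero
  filter_upwards [nhdsWithin_le_nhds h1, nhdsWithin_le_nhds h2,
    nhdsWithin_le_nhds h.mem_iff.eventually_nhds, self_mem_nhdsWithin] with y h1 h2 h3 hy
  refine ⟨h1, ?_, h2, h3⟩
  rw [hEo.frontier_eq] at hy
  apply le_antisymm
  · by_contra! hc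
    have hf := mem_closure_iff_frequently.1 hy.1
    obtain ⟨z, hz, hz1, hz2⟩ :=
      (hf.and_eventually ((h1.continuousAt.eventually (lt_mem_nhds hc)).and h3)).exists
    exact (hz2.1 hz).not_gt hz1
  · by_contra! hc
    exact hy.2 (h3.self_of_nhds.2 hc)

/-- The normalized gradient of one defining function extends the normal to a C¹ unit field on a full
neighbourhood, so that ambient calculus applies to it. -/
theorem IsC2Set.exists_normal_field (hEo : IsOpen E) (hE : IsC2Set E) (hx : x ∈ frontier E) :
    ∃ N : Euc d → Euc d, ContDiffAt ℝ 1 N x ∧ (∀ᶠ y in 𝓝 x, ‖N y‖ = 1) ∧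
      ∀ᶠ y in 𝓝[frontier E] x, outerNormal E y = N y := by
  obtain ⟨g, hg⟩ := hE x hx
  have hG := hg.contDiffAt_gradient
  have h2 : ∀ᶠ y in 𝓝 x, _root_.gradient g y ≠ 0 :=
    hG.continuousAt.eventually_ne hg.gradient_ne_zero
  refine ⟨fun y => ‖_root_.gradient g y‖⁻¹ • _root_.gradient g y, ?_, ?_, ?_⟩
  · exact ((hG.norm ℝ hg.gradient_ne_zero).inv
      (norm_ne_zero_iff.2 hg.gradient_ne_zero)).smul hG
  · filter_upwards [h2] with y hy
    have hn := norm_pos_iff.2 hy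
    rw [norm_smul, norm_inv, norm_norm]; field_simp
  · exact (hg.eventually_isC2DefiningAt hEo).mono fun y hy => hy.outerNormal_eq

theorem IsC2Set.gradNormal_eq (hE : IsC2Set E) (hx : x ∈ frontier E) {N : Euc d → Euc d}
    (hN : ContDiffAt ℝ 1 N x) (hNe : ∀ᶠ y in 𝓝[frontier E] x, outerNormal E y = N y) :
    gradNormal E x = (fderiv ℝ N x).comp (tangentProj E x) := by
  have h1 : HasFDerivWithinAt (outerNormal E) (fderiv ℝ N x) (frontier E) x :=
    (hN.differentiableAt (by norm_num)).hasFDerivAt.hasFDerivWithinAt.congr_of_eventuallyEq hNe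
      (hNe.self_of_nhdsWithin hx)
  have h2 := h1.differentiableWithinAt.hasFDerivWithinAt
  ext1 v
  exact h2.unique_on h1 (hE.mem_tangentConeAt hx (inner_tangentProj (hE.norm_outerNormal hx) v))

theorem IsC2Set.eventually_gradNormal_eq (hE : IsC2Set E) {N : Euc d → Euc d}
    (hN : ContDiffAt ℝ 1 N x) (hNe : ∀ᶠ y in 𝓝[frontier E] x, outerNormal E y = N y) :
    ∀ᶠ y in 𝓝[frontier E] x, gradNormal E y = (fderiv ℝ N y).comp (tangentProj E y) := by
  filter_upwards [nhdsWithin_le_nhds (hN.eventually (by simp)),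
    eventually_eventually_nhdsWithin.2 hNe, self_mem_nhdsWithin] with y h1 h2 h3
  exact hE.gradNormal_eq h3 h1 h2

theorem IsC2Set.continuousOn_outerNormal (hEo : IsOpen E) (hE : IsC2Set E) :
    ContinuousOn (outerNormal E) (frontier E) := by
  intro x hx
  obtain ⟨N, hN, -, hNe⟩ := hE.exists_normal_field hEo hx
  exact hN.continuousAt.continuousWithinAt.congr_of_eventuallyEq hNe (hNe.self_of_nhdsWithin hx)

theorem IsC2Set.continuousOn_gradNormal (hEo : IsOpen E) (hE : IsC2Set E) :
    ContinuousOn (gradNormal E) (frontier E) := by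
  intro x hx
  obtain ⟨N, hN, -, hNe⟩ := hE.exists_normal_field hEo hx
  have hν := hE.continuousOn_outerNormal hEo x hx
  have h1 : ContinuousWithinAt (fun y => (fderiv ℝ N y).comp (tangentProj E y)) (frontier E) x := by
    refine ContinuousWithinAt.clm_comp
      ((hN.fderiv_right (m := 0) (by norm_num)).continuousAt.continuousWithinAt) ?_
    refine continuousWithinAt_const.sub ?_
    have hc : Continuous (fun p : Euc d => (innerSL ℝ p).smulRight p) := by
      have := (ContinuousLinearMap.smulRightL ℝ (Euc d) (Euc d)).continuous₂
      exact this.comp (((innerSL ℝ).continuous).prodMk continuous_id)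
    exact hc.continuousAt.comp_continuousWithinAt hν
  exact h1.congr_of_eventuallyEq (hE.eventually_gradNormal_eq hN hNe)
    (hE.gradNormal_eq hx hN hNe)

/-- Differentiate |N|² = 1 for a C¹ unit extension N of the normal. -/
theorem IsC2Set.inner_gradNormal (hEo : IsOpen E) (hE : IsC2Set E) (hx : x ∈ frontier E)
    (v : Euc d) : ⟪outerNormal E x, gradNormal E x v⟫_ℝ = 0 := by
  obtain ⟨N, hN, hN1, hNe⟩ := hE.exists_normal_field hEo hx
  rw [hE.gradNormal_eq hx hN hNe, hNe.self_of_nhdsWithin hx, ContinuousLinearMap.comp_apply]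
  have hd := (hN.differentiableAt (by norm_num)).hasFDerivAt
  have h1 := hd.inner ℝ hd
  have h2 : HasFDerivAt (fun y => ⟪N y, N y⟫_ℝ) (0 : Euc d →L[ℝ] ℝ) x := by
    refine (hasFDerivAt_const (1 : ℝ) x).congr_of_eventuallyEq ?_
    filter_upwards [hN1] with y hy
    rw [real_inner_self_eq_norm_sq, hy]; norm_num
  have h3 := congrArg (fun L => L (tangentProj E x v)) (h1.unique h2)
  simp only [ContinuousLinearMap.comp_apply, ContinuousLinearMap.prod_apply, fderivInnerCLM_apply,
    _root_.zero_apply, real_inner_comm (N x)] at h3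
  rw [real_inner_comm] at h3
  have := real_inner_comm (N x) ((fderiv ℝ N x) (tangentProj E x v))
  linarith

/-- The defining function vanishes at both points, and its strict differentiability at x controls
its increments over all pairs of nearby points. Hence the linear term alone must be small. -/
theorem IsC2Set.exists_ball_flat (hEo : IsOpen E) (hE : IsC2Set E) (hx : x ∈ frontier E)
    {η : ℝ} (hη : 0 < η) : ∃ r > 0, ∀ y ∈ frontier E ∩ ball x r, ∀ z ∈ frontier E ∩ ball x r,
      |⟪outerNormal E x, y - z⟫_ℝ| ≤ η * ‖y - z‖ := by
  obtain ⟨g, hg⟩ := hE x hx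
  have hn := norm_pos_iff.2 hg.gradient_ne_zero
  have hs := (hg.contDiffAt.hasStrictFDerivAt (by norm_num)).isLittleO.bound
    (c := η * ‖_root_.gradient g x‖) (by positivity)
  have h0 := hg.eventually_isC2DefiningAt hEo
  obtain ⟨r1, hr1, H1⟩ := Metric.eventually_nhds_iff_ball.1 hs
  obtain ⟨r2, hr2, H2⟩ := Metric.mem_nhdsWithin_iff.1 h0
  refine ⟨min r1 r2, lt_min hr1 hr2, fun y hy z hz => ?_⟩
  have hy0 := (H2 ⟨ball_subset_ball (min_le_right _ _) hy.2, hy.1⟩).eq_zero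
  have hz0 := (H2 ⟨ball_subset_ball (min_le_right _ _) hz.2, hz.1⟩).eq_zero
  have := H1 (y, z) (by
    rw [← ball_prod_same]
    exact ⟨ball_subset_ball (min_le_left _ _) hy.2, ball_subset_ball (min_le_left _ _) hz.2⟩)
  simp only [hy0, hz0, sub_self, zero_sub, norm_neg, ← inner_gradient_left, hg.inner_gradient,
    norm_mul, norm_norm] at this
  rw [Real.norm_eq_abs] at this
  refine le_of_mul_le_mul_left (this.trans_eq ?_) hn
  ring

/-- Strict differentiability gives this estimate with the full derivative of an extension N.
Replacing it by ∇ν only drops the normal component of y - z, which is small by flatness. -/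
theorem IsC2Set.exists_ball_gradNormal (hEo : IsOpen E) (hE : IsC2Set E) (hx : x ∈ frontier E)
    {η : ℝ} (hη : 0 < η) : ∃ r > 0, ∀ y ∈ frontier E ∩ ball x r, ∀ z ∈ frontier E ∩ ball x r,
      ‖outerNormal E y - outerNormal E z - gradNormal E x (y - z)‖ ≤ η * ‖y - z‖ := by
  obtain ⟨N, hN, -, hNe⟩ := hE.exists_normal_field hEo hx
  have hs := (hN.hasStrictFDerivAt (by norm_num)).isLittleO.bound (c := η / 2) (by positivity)
  set C := ‖fderiv ℝ N x (outerNormal E x)‖ with hC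
  obtain ⟨r1, hr1, H1⟩ := Metric.eventually_nhds_iff_ball.1 hs
  obtain ⟨r2, hr2, H2⟩ := Metric.mem_nhdsWithin_iff.1 hNe
  obtain ⟨r3, hr3, H3⟩ := hE.exists_ball_flat hEo hx (η := η / 2 / (C + 1)) (by positivity)
  refine ⟨min r1 (min r2 r3), by positivity, fun y hy z hz => ?_⟩
  have hb : ∀ w ∈ frontier E ∩ ball x (min r1 (min r2 r3)),
      w ∈ ball x r1 ∧ outerNormal E w = N w ∧ w ∈ frontier E ∩ ball x r3 := by
    rintro w ⟨hw1, hw2⟩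
    rw [mem_ball, lt_min_iff, lt_min_iff] at hw2
    exact ⟨hw2.1, H2 ⟨hw2.2.1, hw1⟩, hw1, hw2.2.2⟩
  obtain ⟨hy1, hy2, hy3⟩ := hb y hy
  obtain ⟨hz1, hz2, hz3⟩ := hb z hz
  have a1 := H1 (y, z) (by rw [← ball_prod_same]; exact ⟨hy1, hz1⟩)
  have a2 := H3 y hy3 z hz3
  rw [hE.gradNormal_eq hx hN hNe, hy2, hz2, ContinuousLinearMap.comp_apply, tangentProj_apply,
    map_sub (fderiv ℝ N x) (y - z), map_smul]
  have e : N y - N z - (fderiv ℝ N x (y - z) - ⟪outerNormal E x, y - z⟫_ℝ •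
      fderiv ℝ N x (outerNormal E x)) = (N y - N z - fderiv ℝ N x (y - z)) +
      ⟪outerNormal E x, y - z⟫_ℝ • fderiv ℝ N x (outerNormal E x) := by abel
  rw [e]
  refine (norm_add_le _ _).trans ?_
  rw [norm_smul, ← hC, Real.norm_eq_abs]
  have a3 : |⟪outerNormal E x, y - z⟫_ℝ| * C ≤ η / 2 * ‖y - z‖ := by
    have hC0 : 0 ≤ C := norm_nonneg _
    calc |⟪outerNormal E x, y - z⟫_ℝ| * C
        ≤ (η / 2 / (C + 1) * ‖y - z‖) * (C + 1) := by gcongr; linarith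
      _ = η / 2 * ‖y - z‖ := by field_simp
  calc _ ≤ η / 2 * ‖y - z‖ + η / 2 * ‖y - z‖ := add_le_add a1 a3
    _ = _ := by ring

/-- Second order expansion at zero increments of a function with differentiable gradient. -/
theorem IsC2DefiningAt.exists_ball_taylor (hEo : IsOpen E) (h : IsC2DefiningAt E x g) {η : ℝ}
    (hη : 0 < η) : ∃ r > 0, ∀ y ∈ frontier E ∩ ball x r,
      |⟪_root_.gradient g x, y - x⟫_ℝ +
        1 / 2 * ⟪fderiv ℝ (_root_.gradient g) x (y - x), y - x⟫_ℝ| ≤ η * ‖y - x‖ ^ 2 := by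
  have hG := (h.contDiffAt_gradient.differentiableAt (by norm_num)).hasFDerivAt
  have hs := hG.isLittleO.bound hη
  have hd : ∀ᶠ y in 𝓝 x, DifferentiableAt ℝ g y :=
    (h.contDiffAt.eventually (by simp)).mono fun y hy => hy.differentiableAt (by norm_num)
  obtain ⟨r1, hr1, H1⟩ := Metric.eventually_nhds_iff_ball.1 (hs.and hd)
  obtain ⟨r2, hr2, H2⟩ := Metric.mem_nhdsWithin_iff.1 (h.eventually_isC2DefiningAt hEo)
  refine ⟨min r1 r2, lt_min hr1 hr2, fun y hy => ?_⟩
  have hy0 := (H2 ⟨ball_subset_ball (min_le_right _ _) hy.2, hy.1⟩).eq_zero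
  have hyr : y ∈ ball x r1 := ball_subset_ball (min_le_left _ _) hy.2
  set v := y - x with hv
  set G := _root_.gradient g with hGdef
  set L := fderiv ℝ G x with hL
  have hmem : ∀ t ∈ Icc (0 : ℝ) 1, x + t • v ∈ ball x r1 := by
    intro t ht
    rw [mem_ball_iff_norm, add_sub_cancel_left, norm_smul, Real.norm_eq_abs, abs_of_nonneg ht.1]
    rw [mem_ball_iff_norm] at hyr
    nlinarith [norm_nonneg v, ht.2]
  -- Only differentiability of the gradient at x is available, so the quadratic polynomial is
  -- subtracted along the segment. The remainder has derivative at most η‖v‖², and the mean value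
  -- inequality concludes.
  have hder : ∀ t ∈ Icc (0 : ℝ) 1, HasDerivWithinAt
      (fun t : ℝ => g (x + t • v) - (t * ⟪G x, v⟫_ℝ + t ^ 2 * (1 / 2 * ⟪L v, v⟫_ℝ)))
      (⟪G (x + t • v), v⟫_ℝ - (⟪G x, v⟫_ℝ + t * ⟪L v, v⟫_ℝ)) (Icc 0 1) t := by
    intro t ht
    have h1 : HasDerivAt (fun t : ℝ => x + t • v) v t := by
      simpa using ((hasDerivAt_id t).smul_const v).const_add x
    have h2 : HasDerivAt (fun t : ℝ => g (x + t • v)) ⟪G (x + t • v), v⟫_ℝ t := by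
      have := ((H1 _ (hmem t ht)).2.hasGradientAt.hasFDerivAt).comp_hasDerivAt t h1
      exact this
    have h3 : HasDerivAt (fun t : ℝ => t * ⟪G x, v⟫_ℝ + t ^ 2 * (1 / 2 * ⟪L v, v⟫_ℝ))
        (⟪G x, v⟫_ℝ + t * ⟪L v, v⟫_ℝ) t := by
      have := ((hasDerivAt_id t).mul_const ⟪G x, v⟫_ℝ).add
        ((hasDerivAt_pow 2 t).mul_const (1 / 2 * ⟪L v, v⟫_ℝ))
      refine this.congr_deriv ?_
      norm_num; ring
    exact (h2.sub h3).hasDerivWithinAt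
  have hbd : ∀ t ∈ Icc (0 : ℝ) 1,
      ‖⟪G (x + t • v), v⟫_ℝ - (⟪G x, v⟫_ℝ + t * ⟪L v, v⟫_ℝ)‖ ≤ η * ‖v‖ ^ 2 := by
    intro t ht
    have h1 := (H1 _ (hmem t ht)).1
    rw [add_sub_cancel_left, map_smul] at h1
    have e : ⟪G (x + t • v), v⟫_ℝ - (⟪G x, v⟫_ℝ + t * ⟪L v, v⟫_ℝ) =
        ⟪G (x + t • v) - G x - t • L v, v⟫_ℝ := by
      rw [inner_sub_left, inner_sub_left, real_inner_smul_left]; ring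
    rw [e]
    refine (norm_inner_le_norm _ _).trans ?_
    have h2 : ‖t • v‖ ≤ ‖v‖ := by
      rw [norm_smul, Real.norm_eq_abs, abs_of_nonneg ht.1]
      nlinarith [norm_nonneg v, ht.2]
    calc _ ≤ (η * ‖v‖) * ‖v‖ := by
          gcongr
          exact h1.trans (by gcongr)
      _ = _ := by ring
  have := Convex.norm_image_sub_le_of_norm_hasDerivWithin_le hder hbd (convex_Icc 0 1)
    (left_mem_Icc.2 zero_le_one) (right_mem_Icc.2 zero_le_one)
  have hxy : x + v = y := by rw [hv]; abel
  simp only [one_smul, hxy, hy0, zero_smul, add_zero, h.eq_zero, one_pow, one_mul, zero_mul,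
    ne_eq, OfNat.ofNat_ne_zero, not_false_eq_true, zero_pow, sub_zero, sub_self, zero_sub,
    norm_neg, norm_one, mul_one, Real.norm_eq_abs] at this
  exact this

/-- If the ball of radius `|s|` centred at `x + s ν(x)` does not meet `∂E`, then `I + s ∇ν(x)` is
nonnegative on tangent vectors. -/
theorem IsC2Set.inner_gradNormal_nonneg (hEo : IsOpen E) (hE : IsC2Set E) (hx : x ∈ frontier E)
    {s : ℝ} (hs : ∀ y ∈ frontier E, 2 * s * ⟪y - x, outerNormal E x⟫_ℝ ≤ ‖y - x‖ ^ 2)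
    {v : Euc d} (hv : ⟪outerNormal E x, v⟫_ℝ = 0) :
    0 ≤ ‖v‖ ^ 2 + s * ⟪gradNormal E x v, v⟫_ℝ := by
  obtain ⟨g, hg⟩ := hE x hx
  have hn := norm_pos_iff.2 hg.gradient_ne_zero
  set G := _root_.gradient g with hGdef
  have hG := hg.contDiffAt_gradient
  have hGd := (hG.differentiableAt (by norm_num)).hasFDerivAt
  set L := fderiv ℝ G x with hL
  -- relation between the Hessian of `g` and the derivative of the normal
  have hrel : ⟪L v, v⟫_ℝ = ‖G x‖ * ⟪gradNormal E x v, v⟫_ℝ := by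
    have hN : ContDiffAt ℝ 1 (fun y => ‖G y‖⁻¹ • G y) x :=
      ((hG.norm ℝ hg.gradient_ne_zero).inv (norm_ne_zero_iff.2 hg.gradient_ne_zero)).smul hG
    have hNe : ∀ᶠ y in 𝓝[frontier E] x, outerNormal E y = ‖G y‖⁻¹ • G y :=
      (hg.eventually_isC2DefiningAt hEo).mono fun y hy => hy.outerNormal_eq
    rw [hE.gradNormal_eq hx hN hNe, ContinuousLinearMap.comp_apply, tangentProj_of_inner_eq_zero hv]
    have hc := (((hG.norm ℝ hg.gradient_ne_zero).inv
      (norm_ne_zero_iff.2 hg.gradient_ne_zero)).differentiableAt (by norm_num)).hasFDerivAt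
    have hf := (hc.smul hGd).fderiv
    change fderiv ℝ (fun y => ‖G y‖⁻¹ • G y) x = _ at hf
    rw [hf]
    have hGv : ⟪G x, v⟫_ℝ = 0 := by rw [hg.inner_gradient, hv, mul_zero]
    have e : ∀ (c : ℝ) (l : Euc d →L[ℝ] ℝ),
        ⟪(c • L + l.smulRight (G x)) v, v⟫_ℝ = c * ⟪L v, v⟫_ℝ := by
      intro c l
      simp [inner_add_left, real_inner_smul_left, hGv]
    refine ((congrArg (fun z => ‖G x‖ * z) (e ‖G x‖⁻¹ _)).trans ?_).symm
    rw [mul_inv_cancel_left₀ hn.ne']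
  obtain ⟨t, w, ht0, ht, hw, hmem⟩ := hE.exists_seq_tangent hx hv
  have hxw : Tendsto (fun n => x + t n • w n) atTop (𝓝 x) := by
    simpa using (ht.smul hw).const_add x
  -- pass to the limit in the second order expansion
  have key : ∀ η > 0, 0 ≤ ‖G x‖ * ‖v‖ ^ 2 + s * ⟪L v, v⟫_ℝ + 2 * |s| * (η * ‖v‖ ^ 2) := by
    intro η hη
    obtain ⟨r, hr, H⟩ := hg.exists_ball_taylor hEo hη
    have hev : ∀ᶠ n in atTop,
        0 ≤ ‖G x‖ * ‖w n‖ ^ 2 + s * ⟪L (w n), w n⟫_ℝ + 2 * |s| * (η * ‖w n‖ ^ 2) := by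
      filter_upwards [hxw.eventually (ball_mem_nhds x hr)] with n hnb
      have h1 := H _ ⟨hmem n, hnb⟩
      have h2 := hs _ (hmem n)
      have hne : outerNormal E x = ‖G x‖⁻¹ • G x := hg.outerNormal_eq
      simp only [add_sub_cancel_left, map_smul, real_inner_smul_left, real_inner_smul_right,
        norm_smul, hne, mul_pow, Real.norm_eq_abs, sq_abs] at h1 h2
      rw [real_inner_comm] at h2
      have htn := ht0 n
      set a := ⟪G x, w n⟫_ℝ
      set b := ⟪L (w n), w n⟫_ℝ
      -- Contact bounds the first order term s⟨∇g, w⟩ from above. On the boundary, Taylor's formula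
      -- identifies that term with minus half the Hessian term up to η, so dividing by t² leaves a
      -- second order condition.
      have h3 : 2 * s * (t n * a) ≤ ‖G x‖ * (t n ^ 2 * ‖w n‖ ^ 2) := by
        have := mul_le_mul_of_nonneg_left h2 hn.le
        calc 2 * s * (t n * a) = ‖G x‖ * (2 * s * (‖G x‖⁻¹ * (t n * a))) := by
              field_simp
          _ ≤ _ := by convert this using 1
      have h4 : -(s * (t n * a + 1 / 2 * (t n * (t n * b)))) ≤
          |s| * (η * (t n ^ 2 * ‖w n‖ ^ 2)) := by
        refine (neg_le_abs _).trans ?_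
        rw [abs_mul]
        exact mul_le_mul_of_nonneg_left h1 (abs_nonneg s)
      have h5 : 0 ≤ t n ^ 2 *
          (‖G x‖ * ‖w n‖ ^ 2 + s * b + 2 * |s| * (η * ‖w n‖ ^ 2)) := by nlinarith
      exact nonneg_of_mul_nonneg_right h5 (by positivity)
    refine ge_of_tendsto ?_ hev
    have hn2 : Tendsto (fun n => ‖w n‖ ^ 2) atTop (𝓝 (‖v‖ ^ 2)) := hw.norm.pow 2
    have hi : Tendsto (fun n => ⟪L (w n), w n⟫_ℝ) atTop (𝓝 ⟪L v, v⟫_ℝ) :=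
      ((L.continuous.tendsto v).comp hw).inner hw
    exact ((hn2.const_mul _).add (hi.const_mul s)).add ((hn2.const_mul η).const_mul _)
  have h0 : 0 ≤ ‖G x‖ * ‖v‖ ^ 2 + s * ⟪L v, v⟫_ℝ := by
    have ht : Tendsto (fun η : ℝ => ‖G x‖ * ‖v‖ ^ 2 + s * ⟪L v, v⟫_ℝ + 2 * |s| * (η * ‖v‖ ^ 2))
        (𝓝[>] 0) (𝓝 (‖G x‖ * ‖v‖ ^ 2 + s * ⟪L v, v⟫_ℝ)) := by
      have : Continuous (fun η : ℝ =>
        ‖G x‖ * ‖v‖ ^ 2 + s * ⟪L v, v⟫_ℝ + 2 * |s| * (η * ‖v‖ ^ 2)) := by fun_prop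
      simpa using (this.tendsto 0).mono_left nhdsWithin_le_nhds
    exact ge_of_tendsto ht (eventually_mem_nhdsWithin.mono fun η hη => key η hη)
  rw [hrel] at h0
  have : 0 ≤ ‖G x‖ * (‖v‖ ^ 2 + s * ⟪gradNormal E x v, v⟫_ℝ) := by linarith
  exact nonneg_of_mul_nonneg_right this hn

end NormalField

/-- Normal coordinates `(x, s) ↦ x + s ν_E(x)`. -/
noncomputable def normalMap {d : ℕ} (E : Set (Euc d)) (z : Euc d × ℝ) : Euc d :=
  z.1 + z.2 • outerNormal E z.1

/-- The pairs `(x, s)` such that `x` is a nearest point of `∂E` to `x + s ν_E(x)`. -/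
def contactSet {d : ℕ} (E : Set (Euc d)) : Set (Euc d × ℝ) :=
  {z | z.1 ∈ frontier E ∧
    ∀ y ∈ frontier E, 2 * z.2 * ⟪y - z.1, outerNormal E z.1⟫_ℝ ≤ ‖y - z.1‖ ^ 2}

/-- The pairs `(x, s)` that can be prolonged within the contact set. -/
def strictContactSet {d : ℕ} (E : Set (Euc d)) : Set (Euc d × ℝ) :=
  {z | ∃ c : ℝ, 1 < c ∧ (z.1, c * z.2) ∈ contactSet E}

/-! ### Normal coordinates, nearest points and the contact set. -/

section Contact

variable {d : ℕ} {E : Set (Euc d)} {x : Euc d} {s : ℝ}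

theorem norm_normalMap_sub_sq (hn : ‖outerNormal E x‖ = 1) (s : ℝ) (y : Euc d) :
    ‖normalMap E (x, s) - y‖ ^ 2 =
      ‖y - x‖ ^ 2 - 2 * s * ⟪y - x, outerNormal E x⟫_ℝ + s ^ 2 := by
  have e : normalMap E (x, s) - y = s • outerNormal E x - (y - x) := by
    simp only [normalMap]; abel
  rw [e, norm_sub_sq_real, norm_smul, hn, real_inner_smul_left, real_inner_comm, mul_one,
    Real.norm_eq_abs, sq_abs]
  ring

/-- The contact inequality is linear in s with a nonnegative right-hand side, so contact persists
when s shrinks towards 0. -/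
theorem contactSet_smul {t : ℝ} (ht : t ∈ Icc (0 : ℝ) 1) (h : (x, s) ∈ contactSet E) :
    (x, t * s) ∈ contactSet E := by
  refine ⟨h.1, fun y hy => ?_⟩
  have h1 := h.2 y hy
  simp only at h1 ⊢
  calc 2 * (t * s) * ⟪y - x, outerNormal E x⟫_ℝ
      = t * (2 * s * ⟪y - x, outerNormal E x⟫_ℝ) := by ring
    _ ≤ t * ‖y - x‖ ^ 2 := mul_le_mul_of_nonneg_left h1 ht.1
    _ ≤ 1 * ‖y - x‖ ^ 2 := by gcongr; exact ht.2
    _ = _ := one_mul _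

theorem strictContactSet_subset : strictContactSet E ⊆ contactSet E := by
  rintro ⟨x, s⟩ ⟨c, hc, h⟩
  have := contactSet_smul (t := c⁻¹) ⟨by positivity, inv_le_one_of_one_le₀ hc.le⟩ h
  rwa [inv_mul_cancel_left₀ (by positivity)] at this

theorem IsC2Set.mem_contactSet_iff (hE : IsC2Set E) (hx : x ∈ frontier E) :
    (x, s) ∈ contactSet E ↔ ∀ y ∈ frontier E, |s| ≤ dist (normalMap E (x, s)) y := by
  have hn := hE.norm_outerNormal hx
  have : ∀ y, 2 * s * ⟪y - x, outerNormal E x⟫_ℝ ≤ ‖y - x‖ ^ 2 ↔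
      |s| ≤ dist (normalMap E (x, s)) y := by
    intro y
    rw [dist_eq_norm, ← sq_le_sq₀ (abs_nonneg s) (norm_nonneg _), norm_normalMap_sub_sq hn, sq_abs]
    constructor <;> intro h <;> linarith
  simp only [contactSet, mem_ofPred_eq, hx, true_and, this]

theorem IsC2Set.dist_normalMap (hE : IsC2Set E) (hx : x ∈ frontier E) :
    dist (normalMap E (x, s)) x = |s| := by
  rw [dist_eq_norm, normalMap, add_sub_cancel_left, norm_smul, hE.norm_outerNormal hx, mul_one,
    Real.norm_eq_abs]

theorem IsC2Set.infDist_normalMap (hE : IsC2Set E) (h : (x, s) ∈ contactSet E) :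
    infDist (normalMap E (x, s)) (frontier E) = |s| := by
  refine le_antisymm ((infDist_le_dist_of_mem h.1).trans_eq (hE.dist_normalMap h.1)) ?_
  exact (le_infDist ⟨x, h.1⟩).2 fun {y} hy => (hE.mem_contactSet_iff h.1).1 h y hy

/-- This translates the case condition of κ⁺ into contact. If a point of E lay in the ball of radius
s about x + sν, the segment joining it to x + tν with small t > 0, which lies outside E, would stay
in the ball and cross ∂E there. -/
theorem IsC2Set.infDist_eq_iff_contact (hE : IsC2Set E) (hx : x ∈ frontier E)
    (hs : 0 < s) : infDist (x + s • outerNormal E x) E = s ↔ (x, s) ∈ contactSet E := by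
  have hn := hE.norm_outerNormal hx
  have hxc : x ∈ closure E := frontier_subset_closure hx
  have hne : E.Nonempty := closure_nonempty_iff.1 ⟨x, hxc⟩
  have hd := hE.dist_normalMap (s := s) hx
  rw [abs_of_pos hs] at hd
  constructor
  · intro h
    rw [hE.mem_contactSet_iff hx, abs_of_pos hs]
    intro y hy
    rw [← infDist_closure] at h
    exact h.ge.trans (infDist_le_dist_of_mem (frontier_subset_closure hy))
  · intro h
    apply le_antisymm
    · rw [← infDist_closure]
      exact (infDist_le_dist_of_mem hxc).trans_eq hd
    · refine (le_infDist hne).2 fun {y} hy => ?_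
      by_contra! hc
      have hw : 0 < ⟪outerNormal E x, outerNormal E x⟫_ℝ := by
        rw [real_inner_self_eq_norm_sq, hn]; norm_num
      obtain ⟨t, ht1, ht2⟩ := ((hE.eventually_mem_interior_compl hx hw).and
        (Ioo_mem_nhdsGT hs)).exists
      obtain ⟨c, hcs, hcf⟩ := exists_mem_segment_frontier hy (fun hh => interior_subset ht1 hh)
      have hcb : c ∈ ball (normalMap E (x, s)) s := by
        refine (convex_ball _ _).segment_subset ?_ ?_ hcs
        · rw [mem_ball, dist_comm]; exact hc
        · rw [mem_ball, dist_eq_norm]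
          have e : x + t • outerNormal E x - normalMap E (x, s) = (t - s) • outerNormal E x := by
            simp only [normalMap]; module
          rw [e, norm_smul, hn, mul_one, Real.norm_eq_abs, abs_lt]
          constructor <;> linarith [ht2.1, ht2.2]
      have := (hE.mem_contactSet_iff hx).1 h c hcf
      rw [abs_of_pos hs] at this
      rw [mem_ball, dist_comm] at hcb
      linarith

/-- The inner counterpart, with x - tν in E for small t > 0. Inner distances become negative values
of the normal coordinate. -/
theorem IsC2Set.infDist_compl_eq_iff_contact (hEo : IsOpen E) (hE : IsC2Set E)
    (hx : x ∈ frontier E) (hs : 0 < s) :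
    infDist (x - s • outerNormal E x) Eᶜ = s ↔ (x, -s) ∈ contactSet E := by
  have hn := hE.norm_outerNormal hx
  have hsub : frontier E ⊆ Eᶜ := by
    rw [hEo.frontier_eq]; exact fun y hy => hy.2
  have hd := hE.dist_normalMap (s := -s) hx
  have e0 : x - s • outerNormal E x = normalMap E (x, -s) := by simp only [normalMap]; module
  rw [abs_neg, abs_of_pos hs] at hd
  rw [e0]
  constructor
  · intro h
    rw [hE.mem_contactSet_iff hx, abs_neg, abs_of_pos hs]
    intro y hy
    exact h.ge.trans (infDist_le_dist_of_mem (hsub hy))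
  · intro h
    apply le_antisymm
    · exact (infDist_le_dist_of_mem (hsub hx)).trans_eq hd
    · refine (le_infDist ⟨x, hsub hx⟩).2 fun {y} hy => ?_
      by_contra! hc
      have hw : ⟪outerNormal E x, -outerNormal E x⟫_ℝ < 0 := by
        rw [inner_neg_right, real_inner_self_eq_norm_sq, hn]; norm_num
      obtain ⟨t, ht1, ht2⟩ := ((hE.eventually_mem hx hw).and (Ioo_mem_nhdsGT hs)).exists
      obtain ⟨c, hcs, hcf⟩ := exists_mem_segment_frontier ht1 hy
      have hcb : c ∈ ball (normalMap E (x, -s)) s := by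
        refine (convex_ball _ _).segment_subset ?_ ?_ hcs
        · rw [mem_ball, dist_eq_norm]
          have e : x + t • -outerNormal E x - normalMap E (x, -s) =
              (s - t) • outerNormal E x := by
            simp only [normalMap]; module
          rw [e, norm_smul, hn, mul_one, Real.norm_eq_abs, abs_lt]
          constructor <;> linarith [ht2.1, ht2.2]
        · rw [mem_ball, dist_comm]; exact hc
      have := (hE.mem_contactSet_iff hx).1 h c hcf
      rw [abs_neg, abs_of_pos hs] at this
      rw [mem_ball, dist_comm] at hcb
      linarith

/-- Every point has normal coordinates given by a nearest point on the boundary. -/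
theorem IsC2Set.exists_contact (hE : IsC2Set E) (hEb : Bornology.IsBounded E)
    (hne : (frontier E).Nonempty) (y : Euc d) : ∃ z ∈ contactSet E, normalMap E z = y := by
  have hcomp : IsCompact (frontier E) := hEb.isCompact_closure.of_isClosed_subset isClosed_frontier
    frontier_subset_closure
  obtain ⟨x, hx, hxd⟩ := hcomp.exists_infDist_eq_dist hne y
  have hn := hE.norm_outerNormal hx
  have hmin : ∀ w ∈ frontier E, 2 * ⟪y - x, w - x⟫_ℝ ≤ ‖w - x‖ ^ 2 := by
    intro w hw
    have h1 : dist y x ≤ dist y w := hxd ▸ infDist_le_dist_of_mem hw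
    rw [dist_eq_norm, dist_eq_norm, ← sq_le_sq₀ (norm_nonneg _) (norm_nonneg _)] at h1
    have e : y - w = (y - x) - (w - x) := by abel
    rw [e, norm_sub_sq_real (y - x) (w - x)] at h1
    linarith
  -- Here u is the tangential part of y - x. Minimality of x along boundary points approaching in
  -- the direction u gives ⟨y - x, u⟩ ≤ 0, while this inner product equals ‖u‖².
  set u := y - x - ⟪outerNormal E x, y - x⟫_ℝ • outerNormal E x with hu
  have hu0 : ⟪outerNormal E x, u⟫_ℝ = 0 := by
    rw [hu, inner_sub_right, inner_smul_right, real_inner_self_eq_norm_sq, hn]; ring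
  obtain ⟨t, w, ht0, ht, hw, hmem⟩ := hE.exists_seq_tangent hx hu0
  have hle : ∀ n, 2 * ⟪y - x, w n⟫_ℝ ≤ t n * ‖w n‖ ^ 2 := by
    intro n
    have h1 := hmin _ (hmem n)
    rw [add_sub_cancel_left, inner_smul_right, norm_smul, Real.norm_eq_abs, mul_pow, sq_abs] at h1
    refine le_of_mul_le_mul_left ?_ (ht0 n)
    linarith
  have hlim : 2 * ⟪y - x, u⟫_ℝ ≤ 0 * ‖u‖ ^ 2 :=
    le_of_tendsto_of_tendsto' ((tendsto_const_nhds.inner hw).const_mul 2)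
      (ht.mul (hw.norm.pow 2)) hle
  have hself : ⟪y - x, u⟫_ℝ = ‖u‖ ^ 2 := by
    have e : y - x = u + ⟪outerNormal E x, y - x⟫_ℝ • outerNormal E x := by rw [hu]; abel
    conv_lhs => rw [e]
    rw [inner_add_left, real_inner_smul_left, hu0, real_inner_self_eq_norm_sq]; ring
  have huz : u = 0 := by
    have : ‖u‖ ^ 2 = 0 := le_antisymm (by linarith) (by positivity)
    simpa using this
  have hy : normalMap E (x, ⟪outerNormal E x, y - x⟫_ℝ) = y := by
    have : y - x = ⟪outerNormal E x, y - x⟫_ℝ • outerNormal E x := sub_eq_zero.1 (hu ▸ huz)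
    simp only [normalMap]
    rw [← this]; abel
  refine ⟨(x, ⟪outerNormal E x, y - x⟫_ℝ), ?_, hy⟩
  rw [hE.mem_contactSet_iff hx, ← hE.dist_normalMap hx, hy, ← hxd]
  exact fun w hw => infDist_le_dist_of_mem hw

/-- A second nearest point x' turns the contact inequality at s into an equality. Contact at cs then
gives c‖x' - x‖² ≤ ‖x' - x‖² with c > 1, so x' = x. Strictness of one of the two pairs suffices. -/
theorem IsC2Set.eq_of_normalMap_eq (hE : IsC2Set E) {z z' : Euc d × ℝ}
    (hz : z ∈ strictContactSet E) (hz' : z' ∈ contactSet E)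
    (h : normalMap E z = normalMap E z') : z' = z := by
  obtain ⟨x, s⟩ := z
  obtain ⟨x', s'⟩ := z'
  have hzc := strictContactSet_subset hz
  obtain ⟨c, hc, hcs⟩ := hz
  have hn := hE.norm_outerNormal hzc.1
  have hss : |s| = |s'| := by
    rw [← hE.infDist_normalMap hzc, h, hE.infDist_normalMap hz']
  have h1 := norm_normalMap_sub_sq hn s x'
  rw [h, ← dist_eq_norm, hE.dist_normalMap hz'.1, ← hss, sq_abs] at h1
  have h2 := hcs.2 x' hz'.1
  simp only at h2
  have h3 : x' = x := by
    have : c * ‖x' - x‖ ^ 2 ≤ ‖x' - x‖ ^ 2 := by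
      have e : ‖x' - x‖ ^ 2 = 2 * s * ⟪x' - x, outerNormal E x⟫_ℝ := by linarith
      calc c * ‖x' - x‖ ^ 2 = 2 * (c * s) * ⟪x' - x, outerNormal E x⟫_ℝ := by rw [e]; ring
        _ ≤ _ := h2
    have h0 : ‖x' - x‖ ^ 2 = 0 := by nlinarith [sq_nonneg ‖x' - x‖]
    rw [← sub_eq_zero]
    simpa using h0
  subst h3
  have h4 : s • outerNormal E x' = s' • outerNormal E x' := by
    simpa [normalMap] using h
  have hν : outerNormal E x' ≠ 0 := by
    intro h0; rw [h0, norm_zero] at hn; norm_num at hn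
  rw [smul_left_injective ℝ hν h4]

theorem IsC2Set.injOn_normalMap (hE : IsC2Set E) : InjOn (normalMap E) (strictContactSet E) :=
  fun _ hz _ hz' h => (hE.eq_of_normalMap_eq hz (strictContactSet_subset hz') h).symm

theorem IsC2Set.continuousOn_normalMap (hEo : IsOpen E) (hE : IsC2Set E) :
    ContinuousOn (normalMap E) (frontier E ×ˢ univ) := by
  refine continuousOn_fst.add (continuousOn_snd.smul ?_)
  exact (hE.continuousOn_outerNormal hEo).comp continuousOn_fst fun z hz => hz.1

theorem IsC2Set.isClosed_contactSet (hEo : IsOpen E) (hE : IsC2Set E) :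
    IsClosed (contactSet E) := by
  have hc : IsClosed (frontier E ×ˢ (univ : Set ℝ)) := isClosed_frontier.prod isClosed_univ
  have e : contactSet E = (frontier E ×ˢ univ) ∩ ⋂ y ∈ frontier E, (frontier E ×ˢ univ) ∩
      (fun z : Euc d × ℝ => ‖y - z.1‖ ^ 2 - 2 * z.2 * ⟪y - z.1, outerNormal E z.1⟫_ℝ) ⁻¹'
        Ici 0 := by
    ext z
    simp only [contactSet, mem_ofPred_eq, mem_inter_iff, mem_prod, mem_univ, and_true, mem_iInter,
      mem_preimage, mem_Ici, sub_nonneg]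
    exact ⟨fun h => ⟨h.1, fun y hy => ⟨h.1, h.2 y hy⟩⟩, fun h => ⟨h.1, fun y hy => (h.2 y hy).2⟩⟩
  rw [e]
  refine hc.inter (isClosed_biInter fun y _ => ?_)
  refine ContinuousOn.preimage_isClosed_of_isClosed ?_ hc isClosed_Ici
  have hν : ContinuousOn (fun z : Euc d × ℝ => outerNormal E z.1) (frontier E ×ˢ univ) :=
    (hE.continuousOn_outerNormal hEo).comp continuousOn_fst fun z hz => hz.1
  have h1 : ContinuousOn (fun z : Euc d × ℝ => y - z.1) (frontier E ×ˢ univ) := by fun_prop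
  exact (h1.norm.pow 2).sub ((continuousOn_snd.const_mul 2 |>.mul (h1.inner hν)))

/-- Since contact persists when s shrinks, the factor c may be taken of the form 1 + 1/(n+1), which
gives a countable union of closed sets. -/
theorem IsC2Set.measurableSet_strictContactSet (hEo : IsOpen E) (hE : IsC2Set E) :
    MeasurableSet (strictContactSet E) := by
  have e : strictContactSet E = ⋃ n : ℕ,
      (fun z : Euc d × ℝ => (z.1, (1 + 1 / ((n : ℝ) + 1)) * z.2)) ⁻¹' contactSet E := by
    ext z
    simp only [mem_iUnion, mem_preimage]
    constructor
    · rintro ⟨c, hc, h⟩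
      obtain ⟨n, hn⟩ := exists_nat_one_div_lt (sub_pos.2 hc)
      refine ⟨n, ?_⟩
      have := contactSet_smul (t := (1 + 1 / ((n : ℝ) + 1)) / c) ⟨by positivity, ?_⟩ h
      · rwa [← mul_assoc, div_mul_cancel₀ _ (by positivity)] at this
      · rw [div_le_one (by positivity)]; linarith
    · rintro ⟨n, hn⟩
      exact ⟨_, lt_add_of_pos_right 1 (by positivity), hn⟩
  rw [e]
  exact MeasurableSet.iUnion fun n =>
    ((hE.isClosed_contactSet hEo).preimage (by fun_prop)).measurableSet

/-- Along each normal half-line the contact parameters form an interval starting at 0, and only its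
far end can fail to be prolonged. As s = 0 is always strict, at most two values of s remain. -/
theorem volume_slice_contactSet_diff (x : Euc d) :
    volume (Prod.mk x ⁻¹' (contactSet E \ strictContactSet E)) = 0 := by
  set S := Prod.mk x ⁻¹' (contactSet E \ strictContactSet E)
  have h0 : S = (S ∩ Ioi 0) ∪ (S ∩ Iio 0) := by
    rw [← inter_union_distrib_left]
    refine (inter_eq_left.2 fun s hs => ?_).symm
    by_contra h
    have hs0 : s = 0 := by
      simp only [mem_union, mem_Ioi, mem_Iio, not_or, not_lt] at h
      exact le_antisymm h.1 h.2
    subst hs0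
    exact hs.2 ⟨2, by norm_num, by simpa using hs.1⟩
  have hle : ∀ a b : ℝ, a ∈ S → b ∈ S → 0 < a * b → |a| ≤ |b| := by
    intro a b ha hb hab
    by_contra! hlt
    have hb0 : b ≠ 0 := by rintro rfl; simp at hab
    refine hb.2 ⟨a / b, ?_, ?_⟩
    · have : a / b = |a| / |b| := by
        rw [← abs_div, abs_of_pos]
        rw [div_eq_mul_inv]
        have : a * b⁻¹ = a * b * (b⁻¹) ^ 2 := by field_simp
        rw [this]; positivity
      rw [this, one_lt_div (abs_pos.2 hb0)]
      exact hlt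
    · simpa [div_mul_cancel₀ _ hb0] using ha.1
  have h1 : (S ∩ Ioi 0).Subsingleton := by
    rintro a ⟨ha, ha0⟩ b ⟨hb, hb0⟩
    have ha0' : (0 : ℝ) < a := ha0
    have hb0' : (0 : ℝ) < b := hb0
    have h1 := hle a b ha hb (by positivity)
    have h2 := hle b a hb ha (by positivity)
    rw [abs_of_pos ha0', abs_of_pos hb0'] at *
    exact le_antisymm h1 h2
  have h2 : (S ∩ Iio 0).Subsingleton := by
    rintro a ⟨ha, ha0⟩ b ⟨hb, hb0⟩
    have ha0' : a < (0 : ℝ) := ha0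
    have hb0' : b < (0 : ℝ) := hb0
    have h1 := hle a b ha hb (mul_pos_of_neg_of_neg ha0 hb0)
    have h2 := hle b a hb ha (mul_pos_of_neg_of_neg hb0 ha0)
    rw [abs_of_neg ha0', abs_of_neg hb0'] at *
    linarith
  rw [h0]
  exact measure_union_null (h1.measure_zero _) (h2.measure_zero _)

theorem IsC2Set.measure_contactSet_diff (hEo : IsOpen E) (hE : IsC2Set E)
    (μ : Measure (Euc d)) :
    (μ.prod volume) (contactSet E \ strictContactSet E) = 0 := by
  rw [Measure.measure_prod_null ((hE.isClosed_contactSet hEo).measurableSet.diff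
    (hE.measurableSet_strictContactSet hEo))]
  exact Eventually.of_forall fun x => volume_slice_contactSet_diff x

/-- For 0 ≤ t < 1 the form ‖v‖² + ts⟨∇ν v, v⟩ is positive on nonzero tangent vectors. Any kernel
vector of I + ts∇ν is tangent because ∇ν has tangential values, so the determinant does not vanish
on [0,1). It equals 1 at t = 0, hence cannot become negative at t = 1. -/
theorem IsC2Set.det_nonneg (hEo : IsOpen E) (hE : IsC2Set E) (h : (x, s) ∈ contactSet E) :
    0 ≤ (ContinuousLinearMap.id ℝ (Euc d) + s • gradNormal E x).det := by
  have hx := h.1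
  have hn := hE.norm_outerNormal hx
  have hcont : Continuous fun t : ℝ =>
      (ContinuousLinearMap.id ℝ (Euc d) + (t * s) • gradNormal E x).det :=
    ContinuousLinearMap.continuous_det.comp (by fun_prop)
  have hne : ∀ t ∈ Ico (0 : ℝ) 1,
      (ContinuousLinearMap.id ℝ (Euc d) + (t * s) • gradNormal E x).det ≠ 0 := by
    intro t ht h0
    have hker := LinearMap.bot_lt_ker_of_det_eq_zero h0
    obtain ⟨v, hv, hv0⟩ := (Submodule.ne_bot_iff _).1 hker.ne'
    have hv1 : v + (t * s) • gradNormal E x v = 0 := by simpa using hv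
    set w := tangentProj E x v with hw
    have hw0 : ⟪outerNormal E x, w⟫_ℝ = 0 := inner_tangentProj hn v
    have hMw : gradNormal E x v = gradNormal E x w := by
      simp only [gradNormal, ContinuousLinearMap.comp_apply]
      rw [← hw, tangentProj_of_inner_eq_zero hw0]
    have hνv : ⟪outerNormal E x, v⟫_ℝ = 0 := by
      have := congrArg (fun u => ⟪outerNormal E x, u⟫_ℝ) hv1
      simpa [inner_add_right, inner_smul_right, hE.inner_gradNormal hEo hx] using this
    have hwv : w = v := tangentProj_of_inner_eq_zero hνv
    have h1 := hE.inner_gradNormal_nonneg hEo hx h.2 hνv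
    have h2 : ‖v‖ ^ 2 + t * (s * ⟪gradNormal E x v, v⟫_ℝ) = 0 := by
      have := congrArg (fun u => ⟪u, v⟫_ℝ) hv1
      simp only [inner_add_left, real_inner_smul_left, real_inner_self_eq_norm_sq,
        inner_zero_left] at this
      linarith
    have h3 : 0 < ‖v‖ ^ 2 := by have := norm_pos_iff.2 hv0; positivity
    nlinarith [ht.1, ht.2, mul_nonneg ht.1 h1]
  by_contra! hneg
  obtain ⟨t, ht, ht0⟩ := intermediate_value_Icc' zero_le_one hcont.continuousOn
    (show (0 : ℝ) ∈ Icc _ _ by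
      constructor
      · simpa using hneg.le
      · simp [ContinuousLinearMap.det])
  rcases ht.2.lt_or_eq with h1 | rfl
  · exact hne t ⟨ht.1, h1⟩ ht0
  · simp only [one_mul] at ht0
    exact hneg.ne ht0

end Contact

theorem LipschitzOnWith.euclideanHausdorffMeasure_image_le {X Y : Type*} [EMetricSpace X]
    [EMetricSpace Y] [MeasurableSpace X] [BorelSpace X] [MeasurableSpace Y] [BorelSpace Y]
    {K : ℝ≥0} {f : X → Y} {s : Set X} (h : LipschitzOnWith K f s) (n : ℕ) :
    (Measure.euclideanHausdorffMeasure n) (f '' s) ≤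
      (K : ℝ≥0∞) ^ n * Measure.euclideanHausdorffMeasure n s := by
  simp only [Measure.euclideanHausdorffMeasure_def, Measure.smul_apply, ENNReal.smul_def,
    smul_eq_mul]
  have := h.hausdorffMeasure_image_le (d := n) (by positivity)
  rw [ENNReal.rpow_natCast] at this
  calc _ ≤ _ := mul_le_mul_right this _
    _ = _ := by ring

/-! ### From local estimates on a set function to an integral formula. -/

section Abstract

variable {X : Type*} [TopologicalSpace X] [SecondCountableTopology X] [MeasurableSpace X]
  [OpensMeasurableSpace X]

/-- By the Lindelöf property countably many neighbourhoods cover A; their traces on A are then made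
disjoint. -/
theorem exists_measurable_partition_of_nhds {A : Set X} (hA : MeasurableSet A)
    (U : X → Set X) (hU : ∀ x ∈ A, U x ∈ 𝓝 x) :
    ∃ B : ℕ → Set X, (∀ n, MeasurableSet (B n)) ∧ Pairwise (Function.onFun Disjoint B) ∧
      ⋃ n, B n = A ∧ ∀ n, B n = ∅ ∨ ∃ x ∈ A, B n ⊆ A ∩ U x := by
  rcases A.eq_empty_or_nonempty with rfl | hne
  · exact ⟨fun _ => ∅, by simp, by intro i j _; simp [Function.onFun], by simp, by simp⟩
  obtain ⟨t, htA, htc, hcov⟩ := TopologicalSpace.countable_cover_nhdsWithin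
    (f := fun x => interior (U x)) (s := A)
    (fun x hx => mem_nhdsWithin_of_mem_nhds (interior_mem_nhds.2 (hU x hx)))
  have htne : t.Nonempty := by
    by_contra h
    rw [not_nonempty_iff_eq_empty] at h
    subst h
    simp only [mem_empty_iff_false, iUnion_of_empty, iUnion_empty] at hcov
    exact hne.ne_empty (subset_empty_iff.1 hcov)
  obtain ⟨u, rfl⟩ := htc.exists_eq_range htne
  refine ⟨disjointed fun n => A ∩ interior (U (u n)), ?_, disjoint_disjointed _, ?_, ?_⟩
  · exact fun n => MeasurableSet.disjointed
      (fun n => hA.inter isOpen_interior.measurableSet) n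
  · rw [iUnion_disjointed, ← inter_iUnion, inter_eq_left]
    simpa using hcov
  · intro n
    exact Or.inr ⟨u n, htA (mem_range_self n), (disjointed_subset _ n).trans
      (inter_subset_inter_right _ interior_subset)⟩

/-- A countably additive set function that locally agrees with `D μ` up to an arbitrarily small
multiple of `μ` is equal to `D μ`. -/
theorem eq_setLIntegral_of_local {μ : Measure X} {A : Set X} (hA : MeasurableSet A)
    (hμA : μ A ≠ ∞) {ν : Set X → ℝ≥0∞} (hν0 : ν ∅ = 0)
    (hν : ∀ B : ℕ → Set X, (∀ n, MeasurableSet (B n)) → (∀ n, B n ⊆ A) →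
      Pairwise (Function.onFun Disjoint B) → ν (⋃ n, B n) = ∑' n, ν (B n)) {D : X → ℝ≥0∞}
    (h : ∀ η : ℝ≥0, 0 < η → ∀ x ∈ A, ∃ U ∈ 𝓝 x, ∀ B ⊆ A ∩ U, MeasurableSet B →
      ν B ≤ ∫⁻ y in B, D y ∂μ + η * μ B ∧ ∫⁻ y in B, D y ∂μ ≤ ν B + η * μ B) :
    ν A = ∫⁻ y in A, D y ∂μ := by
  -- Summed over a countable partition, the local errors amount to η μ(A), which tends to 0 with η
  -- because μ(A) is finite.
  have key : ∀ η : ℝ≥0, 0 < η →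
      ν A ≤ ∫⁻ y in A, D y ∂μ + η * μ A ∧ ∫⁻ y in A, D y ∂μ ≤ ν A + η * μ A := by
    intro η hη
    choose! U hU1 hU2 using h η hη
    obtain ⟨B, hBm, hBd, hBA, hB⟩ := exists_measurable_partition_of_nhds hA U hU1
    have hsub : ∀ n, B n ⊆ A := fun n => hBA ▸ subset_iUnion B n
    have hloc : ∀ n, ν (B n) ≤ ∫⁻ y in B n, D y ∂μ + η * μ (B n) ∧
        ∫⁻ y in B n, D y ∂μ ≤ ν (B n) + η * μ (B n) := by
      intro n
      rcases hB n with h0 | ⟨x, hx, hx'⟩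
      · simp [h0, hν0]
      · exact hU2 x hx _ hx' (hBm n)
    have e1 : ν A = ∑' n, ν (B n) := by rw [← hν B hBm hsub hBd, hBA]
    have e2 : μ A = ∑' n, μ (B n) := by rw [← measure_iUnion hBd hBm, hBA]
    have e3 : ∫⁻ y in A, D y ∂μ = ∑' n, ∫⁻ y in B n, D y ∂μ := by
      rw [← lintegral_iUnion hBm hBd, hBA]
    rw [e1, e2, e3, ← ENNReal.tsum_mul_left, ← ENNReal.tsum_add, ← ENNReal.tsum_add]
    exact ⟨ENNReal.tsum_le_tsum fun n => (hloc n).1, ENNReal.tsum_le_tsum fun n => (hloc n).2⟩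
  have hlim : ∀ c : ℝ≥0∞, Tendsto (fun η : ℝ≥0 => c + η * μ A) (𝓝[>] 0) (𝓝 c) := by
    intro c
    have h1 : Tendsto (fun η : ℝ≥0 => (η : ℝ≥0∞)) (𝓝[>] 0) (𝓝 0) := by
      have : Tendsto (fun η : ℝ≥0 => (η : ℝ≥0∞)) (𝓝 0) (𝓝 ((0 : ℝ≥0) : ℝ≥0∞)) :=
        ENNReal.continuous_coe.tendsto 0
      exact this.mono_left nhdsWithin_le_nhds
    have h2 := (ENNReal.Tendsto.mul_const h1 (Or.inr hμA)).const_add c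
    simpa using h2
  apply le_antisymm
  · exact ge_of_tendsto (hlim _) (eventually_mem_nhdsWithin.mono fun η hη => (key η hη).1)
  · exact ge_of_tendsto (hlim _) (eventually_mem_nhdsWithin.mono fun η hη => (key η hη).2)

end Abstract

/-! ### Tangential projection, flat coordinates and surface measure. -/

section Chart

variable {d : ℕ} {E : Set (Euc d)} {x : Euc d}

/-- The linearized normal coordinates at `x`: tangential projection and normal height. -/
noncomputable def flatMap (E : Set (Euc d)) (x : Euc d) (z : Euc d × ℝ) : Euc d :=
  tangentProj E x z.1 + z.2 • outerNormal E x

theorem continuous_flatMap : Continuous (flatMap E x) := by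
  unfold flatMap; fun_prop

theorem norm_tangentProj_le (hn : ‖outerNormal E x‖ = 1) (v : Euc d) :
    ‖tangentProj E x v‖ ≤ ‖v‖ := by
  have h0 := inner_tangentProj hn v
  have e : v = tangentProj E x v + ⟪outerNormal E x, v⟫_ℝ • outerNormal E x := by
    rw [tangentProj_apply]; abel
  have h1 : ‖v‖ ^ 2 = ‖tangentProj E x v‖ ^ 2 + ⟪outerNormal E x, v⟫_ℝ ^ 2 := by
    conv_lhs => rw [e]
    rw [norm_add_sq_real, real_inner_smul_right, real_inner_comm (outerNormal E x), h0, norm_smul,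
      hn, Real.norm_eq_abs, mul_one, sq_abs]
    ring
  rw [← sq_le_sq₀ (norm_nonneg _) (norm_nonneg _)]
  nlinarith [sq_nonneg ⟪outerNormal E x, v⟫_ℝ]

theorem norm_flatMap_sq (hn : ‖outerNormal E x‖ = 1) (z : Euc d × ℝ) :
    ‖flatMap E x z‖ ^ 2 = ‖tangentProj E x z.1‖ ^ 2 + z.2 ^ 2 := by
  have h0 := inner_tangentProj hn z.1
  rw [flatMap, norm_add_sq_real, real_inner_smul_right, real_inner_comm, h0, norm_smul, hn,
      Real.norm_eq_abs, mul_one, sq_abs]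
  ring

theorem flatMap_sub (z z' : Euc d × ℝ) :
    flatMap E x z - flatMap E x z' = flatMap E x (z - z') := by
  simp only [flatMap, Prod.fst_sub, Prod.snd_sub, map_sub, sub_smul]
  abel

/-- By flatness the normal component of y - z is at most (1 - 1/K)‖y - z‖. The tangential projection
is thus bi-Lipschitz near x with constants as close to 1 as desired, which is what makes the area
formula sharp. -/
theorem IsC2Set.exists_ball_proj (hEo : IsOpen E) (hE : IsC2Set E) (hx : x ∈ frontier E)
    {K : ℝ} (hK : 1 < K) : ∃ r > 0, ∀ y ∈ frontier E ∩ ball x r, ∀ z ∈ frontier E ∩ ball x r,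
      ‖y - z‖ ≤ K * ‖tangentProj E x (y - z)‖ := by
  obtain ⟨r, hr, H⟩ := hE.exists_ball_flat hEo hx (η := 1 - K⁻¹)
    (by rw [sub_pos]; exact inv_lt_one_of_one_lt₀ hK)
  refine ⟨r, hr, fun y hy z hz => ?_⟩
  have h1 := H y hy z hz
  have hn := hE.norm_outerNormal hx
  have e : y - z = tangentProj E x (y - z) + ⟪outerNormal E x, y - z⟫_ℝ • outerNormal E x := by
    rw [tangentProj_apply]; abel
  have h2 : ‖y - z‖ ≤ ‖tangentProj E x (y - z)‖ + |⟪outerNormal E x, y - z⟫_ℝ| := by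
    conv_lhs => rw [e]
    refine (norm_add_le _ _).trans_eq ?_
    rw [norm_smul, hn, mul_one, Real.norm_eq_abs]
  have h3 : K⁻¹ * ‖y - z‖ ≤ ‖tangentProj E x (y - z)‖ := by nlinarith
  have h4 : (0 : ℝ) < K := by linarith
  calc ‖y - z‖ = K * (K⁻¹ * ‖y - z‖) := by field_simp
    _ ≤ _ := by gcongr

theorem injOn_flatMap {K r : ℝ} (hn : ‖outerNormal E x‖ = 1)
    (hr : ∀ y ∈ frontier E ∩ ball x r, ∀ z ∈ frontier E ∩ ball x r,
      ‖y - z‖ ≤ K * ‖tangentProj E x (y - z)‖) :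
    InjOn (flatMap E x) ((frontier E ∩ ball x r) ×ˢ univ) := by
  intro z hz z' hz' h
  have h1 := norm_flatMap_sq hn (z - z')
  rw [← flatMap_sub, h, sub_self, norm_zero] at h1
  have h2 : ‖tangentProj E x (z - z').1‖ = 0 := by
    have : ‖tangentProj E x (z - z').1‖ ^ 2 = 0 := by
      nlinarith [sq_nonneg ‖tangentProj E x (z - z').1‖, sq_nonneg (z - z').2]
    simpa using this
  have h3 : (z - z').2 = 0 := by
    have : (z - z').2 ^ 2 = 0 := by
      nlinarith [sq_nonneg ‖tangentProj E x (z - z').1‖, sq_nonneg (z - z').2]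
    simpa using this
  have h4 := hr z.1 hz.1 z'.1 hz'.1
  rw [← Prod.fst_sub, h2, mul_zero] at h4
  have h5 : (z - z').1 = 0 := norm_le_zero_iff.1 h4
  exact sub_eq_zero.1 (Prod.ext h5 h3)

theorem hausdorff_tangentProj_le (hn : ‖outerNormal E x‖ = 1) (n : ℕ) (B : Set (Euc d)) :
    Measure.euclideanHausdorffMeasure n (tangentProj E x '' B) ≤
      Measure.euclideanHausdorffMeasure n B := by
  have h : LipschitzOnWith 1 (tangentProj E x) B := by
    refine LipschitzOnWith.of_dist_le_mul fun y _ z _ => ?_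
    rw [dist_eq_norm, dist_eq_norm, ← map_sub, NNReal.coe_one, one_mul]
    exact norm_tangentProj_le hn _
  simpa using h.euclideanHausdorffMeasure_image_le n

theorem hausdorff_le_tangentProj {K : ℝ≥0} {r : ℝ}
    (hr : ∀ y ∈ frontier E ∩ ball x r, ∀ z ∈ frontier E ∩ ball x r,
      ‖y - z‖ ≤ K * ‖tangentProj E x (y - z)‖) (n : ℕ) {B : Set (Euc d)}
    (hB : B ⊆ frontier E ∩ ball x r) :
    Measure.euclideanHausdorffMeasure n B ≤
      (K : ℝ≥0∞) ^ n * Measure.euclideanHausdorffMeasure n (tangentProj E x '' B) := by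
  set i := Function.invFunOn (tangentProj E x) B
  have hi : ∀ y ∈ B, i (tangentProj E x y) = y := by
    intro y hy
    have h1 : ∃ a ∈ B, tangentProj E x a = tangentProj E x y := ⟨y, hy, rfl⟩
    have h2 := Function.invFunOn_mem h1
    have h3 := Function.invFunOn_eq h1
    have h4 := hr _ (hB h2) y (hB hy)
    rw [map_sub, h3, sub_self, norm_zero, mul_zero] at h4
    exact sub_eq_zero.1 (norm_le_zero_iff.1 h4)
  have hl : LipschitzOnWith K i (tangentProj E x '' B) := by
    refine LipschitzOnWith.of_dist_le_mul ?_
    rintro _ ⟨y, hy, rfl⟩ _ ⟨z, hz, rfl⟩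
    rw [hi y hy, hi z hz, dist_eq_norm, dist_eq_norm, ← map_sub]
    exact hr y (hB hy) z (hB hz)
  have := hl.euclideanHausdorffMeasure_image_le n
  have e : i '' (tangentProj E x '' B) = B := by
    rw [image_image]
    exact (image_congr hi).trans (image_id' B)
  rwa [e] at this

/-- Slice the volume by hyperplanes orthogonal to ν(x). The slice at height s is a translate of the
tangential projection of the section of B at s. -/
theorem volume_flatMap_image {K r : ℝ} (hn : ‖outerNormal E x‖ = 1)
    (hr : ∀ y ∈ frontier E ∩ ball x r, ∀ z ∈ frontier E ∩ ball x r,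
      ‖y - z‖ ≤ K * ‖tangentProj E x (y - z)‖) {B : Set (Euc d × ℝ)} (hBm : MeasurableSet B)
    (hB : B ⊆ (frontier E ∩ ball x r) ×ˢ univ) :
    volume (flatMap E x '' B) = ∫⁻ s : ℝ, Measure.euclideanHausdorffMeasure (d - 1)
      (tangentProj E x '' ((fun y => (y, s)) ⁻¹' B)) := by
  have hm : MeasurableSet (flatMap E x '' B) :=
    hBm.image_of_continuousOn_injOn continuous_flatMap.continuousOn ((injOn_flatMap hn hr).mono hB)
  have hν : outerNormal E x ≠ 0 := by
    intro h0; rw [h0, norm_zero] at hn; norm_num at hn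
  have h1 := EuclideanGeometry.euclideanHausdorffMeasure_eq_lintegral (0 : Euc d) hν hm
  rw [InnerProductSpace.euclideanHausdorffMeasure_eq_volume, finrank_euclideanSpace_fin] at h1
  rw [h1]
  have : ‖outerNormal E x‖ₑ = 1 := by rw [← ofReal_norm, hn, ENNReal.ofReal_one]
  rw [this, one_mul]
  refine lintegral_congr fun s => ?_
  have e : flatMap E x '' B ∩
      (AffineSubspace.mk' (s • outerNormal E x +ᵥ (0 : Euc d)) (ℝ ∙ outerNormal E x)ᗮ :
        Set (Euc d)) =
      (fun y => s • outerNormal E x + y) '' (tangentProj E x '' ((fun y => (y, s)) ⁻¹' B)) := by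
    ext y
    simp only [mem_inter_iff, SetLike.mem_coe, AffineSubspace.mem_mk',
      Submodule.mem_orthogonal_singleton_iff_inner_right, vadd_eq_add, add_zero, vsub_eq_sub,
      mem_image, mem_preimage, exists_exists_and_eq_and]
    constructor
    · rintro ⟨⟨⟨a, t⟩, hat, rfl⟩, h2⟩
      have : t = s := by
        simp only [flatMap, inner_sub_right, inner_add_right, inner_tangentProj hn,
          inner_smul_right, real_inner_self_eq_norm_sq, hn] at h2
        linarith
      subst this
      exact ⟨a, hat, by simp only [flatMap]; abel⟩
    · rintro ⟨a, ha, rfl⟩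
      refine ⟨⟨(a, s), ha, by simp only [flatMap]; abel⟩, ?_⟩
      rw [add_sub_cancel_left, inner_tangentProj hn]
  rw [e]
  exact (Isometry.of_dist_eq fun a b => by simp).euclideanHausdorffMeasure_image _

/-- Near each point the boundary is a 2-Lipschitz image of a bounded piece of a hyperplane of
dimension d - 1, where the Hausdorff measure is Lebesgue measure. Compactness does the rest. -/
theorem IsC2Set.hausdorff_frontier_lt_top (hEo : IsOpen E) (hE : IsC2Set E)
    (hEb : Bornology.IsBounded E) :
    Measure.euclideanHausdorffMeasure (d - 1) (frontier E) < ∞ := by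
  have hcomp : IsCompact (frontier E) := hEb.isCompact_closure.of_isClosed_subset isClosed_frontier
    frontier_subset_closure
  have : ∀ S : Set (Euc d), S = frontier E →
      Measure.euclideanHausdorffMeasure (d - 1) S < ∞ := by
    intro S hS
    have hS' : IsCompact S := hS ▸ hcomp
    refine hS'.measure_lt_top_of_nhdsWithin fun x hx => ?_
    rw [hS] at hx
    have hn := hE.norm_outerNormal hx
    obtain ⟨r, hr0, hr⟩ := hE.exists_ball_proj hEo hx (K := (2 : ℝ≥0)) (by norm_num)
    refine ⟨S ∩ ball x r, inter_mem_nhdsWithin _ (ball_mem_nhds x hr0), ?_⟩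
    rw [hS]
    refine (hausdorff_le_tangentProj hr (d - 1) subset_rfl).trans_lt
      (ENNReal.mul_lt_top (by simp) ?_)
    set T := (ℝ ∙ outerNormal E x)ᗮ with hT
    have hν : outerNormal E x ≠ 0 := by
      intro h0; rw [h0, norm_zero] at hn; norm_num at hn
    have hfin : Module.finrank ℝ T = d - 1 := by
      have h1 := (ℝ ∙ outerNormal E x).finrank_add_finrank_orthogonal
      rw [finrank_span_singleton hν, finrank_euclideanSpace_fin, ← hT] at h1
      omega
    have hsub : tangentProj E x '' (frontier E ∩ ball x r) ⊆
        Subtype.val '' (closedBall (0 : T) (‖x‖ + r)) := by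
      rintro _ ⟨y, hy, rfl⟩
      refine ⟨⟨tangentProj E x y, ?_⟩, ?_, rfl⟩
      · rw [hT, Submodule.mem_orthogonal_singleton_iff_inner_right]
        exact inner_tangentProj hn y
      · rw [mem_closedBall_zero_iff]
        refine (norm_tangentProj_le hn y).trans ?_
        have := hy.2
        rw [mem_ball_iff_norm] at this
        have h2 := norm_add_le (y - x) x
        rw [sub_add_cancel] at h2
        linarith
    refine (measure_mono hsub).trans_lt ?_
    rw [isometry_subtype_coe.euclideanHausdorffMeasure_image, ← hfin,
      InnerProductSpace.euclideanHausdorffMeasure_eq_volume]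
    exact measure_closedBall_lt_top
  exact this _ rfl

end Chart

/-- The surface measure on the boundary. -/
noncomputable def boundaryMeasure {d : ℕ} (E : Set (Euc d)) : Measure (Euc d) :=
  (Measure.euclideanHausdorffMeasure (d - 1)).restrict (frontier E)

/-- The Jacobian matrix `I + s ∇ν_E(x)` of the normal coordinates. -/
noncomputable def normalDeriv {d : ℕ} (E : Set (Euc d)) (z : Euc d × ℝ) : Euc d →L[ℝ] Euc d :=
  ContinuousLinearMap.id ℝ (Euc d) + z.2 • gradNormal E z.1

/-! ### The area formula for normal coordinates. -/

section Area

variable {d : ℕ} {E : Set (Euc d)} {x : Euc d}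

theorem IsC2Set.isFiniteMeasure_boundaryMeasure (hEo : IsOpen E) (hE : IsC2Set E)
    (hEb : Bornology.IsBounded E) : IsFiniteMeasure (boundaryMeasure E) :=
  ⟨by rw [boundaryMeasure, Measure.restrict_apply_univ]
      exact hE.hausdorff_frontier_lt_top hEo hEb⟩

theorem volume_flatMap_image_bounds [SFinite (boundaryMeasure E)] {K : ℝ≥0} {r : ℝ}
    (hn : ‖outerNormal E x‖ = 1)
    (hr : ∀ y ∈ frontier E ∩ ball x r, ∀ z ∈ frontier E ∩ ball x r,
      ‖y - z‖ ≤ K * ‖tangentProj E x (y - z)‖) {B : Set (Euc d × ℝ)} (hBm : MeasurableSet B)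
    (hB : B ⊆ (frontier E ∩ ball x r) ×ˢ univ) :
    volume (flatMap E x '' B) ≤ (boundaryMeasure E).prod volume B ∧
      (boundaryMeasure E).prod volume B ≤ (K : ℝ≥0∞) ^ (d - 1) * volume (flatMap E x '' B) := by
  have hs : ∀ s : ℝ, boundaryMeasure E ((fun y => (y, s)) ⁻¹' B) =
      Measure.euclideanHausdorffMeasure (d - 1) ((fun y => (y, s)) ⁻¹' B) := by
    intro s
    rw [boundaryMeasure, Measure.restrict_apply (measurable_prodMk_right hBm)]
    congr 1
    exact inter_eq_left.2 fun y hy => (hB hy).1.1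
  rw [volume_flatMap_image hn hr hBm hB, Measure.prod_apply_symm hBm]
  simp only [hs]
  constructor
  · exact lintegral_mono fun s => hausdorff_tangentProj_le hn _ _
  · rw [← lintegral_const_mul' _ _ (by finiteness)]
    exact lintegral_mono fun s => hausdorff_le_tangentProj hr _ fun y hy => (hB hy).1

theorem gradNormal_outerNormal (hn : ‖outerNormal E x‖ = 1) :
    gradNormal E x (outerNormal E x) = 0 := by
  have : tangentProj E x (outerNormal E x) = 0 := by
    rw [tangentProj_apply, real_inner_self_eq_norm_sq, hn]; simp
  rw [gradNormal, ContinuousLinearMap.comp_apply, this, map_zero]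

theorem gradNormal_tangentProj (hn : ‖outerNormal E x‖ = 1) (v : Euc d) :
    gradNormal E x (tangentProj E x v) = gradNormal E x v := by
  rw [tangentProj_apply, map_sub, map_smul, gradNormal_outerNormal hn, smul_zero, sub_zero]

/-- The linearization error splits into four parts, small respectively by flatness of the boundary,
differentiability of ν along it, closeness of s to s₀, and continuity of ν. -/
theorem normalMap_sub_sub (hn : ‖outerNormal E x‖ = 1) (s₀ : ℝ) (y y' : Euc d) (s s' : ℝ) :
    normalMap E (y, s) - normalMap E (y', s') -
      normalDeriv E (x, s₀) (flatMap E x ((y, s) - (y', s'))) =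
      ⟪outerNormal E x, y - y'⟫_ℝ • outerNormal E x +
      s • (outerNormal E y - outerNormal E y' - gradNormal E x (y - y')) +
      (s - s₀) • gradNormal E x (y - y') +
      (s - s') • (outerNormal E y' - outerNormal E x) := by
  have e1 : normalDeriv E (x, s₀) (flatMap E x ((y, s) - (y', s'))) =
      flatMap E x ((y, s) - (y', s')) + s₀ • gradNormal E x (y - y') := by
    simp only [normalDeriv, flatMap, Prod.mk_sub_mk, add_apply,
      smul_apply, ContinuousLinearMap.id_apply, map_add, map_smul,
      gradNormal_tangentProj hn, gradNormal_outerNormal hn, smul_zero, add_zero]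
    abel
  rw [e1]
  simp only [flatMap, normalMap, Prod.mk_sub_mk, tangentProj_apply]
  module

theorem IsC2Set.exists_normalMap_approx (hEo : IsOpen E) (hE : IsC2Set E) (hx : x ∈ frontier E)
    (s₀ : ℝ) {δ : ℝ} (hδ : 0 < δ) : ∃ r > 0, ∀ z ∈ (frontier E ∩ ball x r) ×ˢ ball s₀ r,
      ∀ z' ∈ (frontier E ∩ ball x r) ×ˢ ball s₀ r,
      ‖normalMap E z - normalMap E z' -
        normalDeriv E (x, s₀) (flatMap E x z - flatMap E x z')‖ ≤
        δ * ‖flatMap E x z - flatMap E x z'‖ := by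
  have hn := hE.norm_outerNormal hx
  set M := gradNormal E x with hM
  -- In units of the flat distance ρ, the four error terms cost η, (|s₀| + 1)η, η and η, in total (4
  -- + |s₀|)η. This choice of η keeps the sum below δ.
  set η : ℝ := δ / (5 + 2 * |s₀|) with hη
  have hη0 : 0 < η := by positivity
  obtain ⟨r1, hr1, H1⟩ := hE.exists_ball_proj hEo hx (K := 2) (by norm_num)
  obtain ⟨r2, hr2, H2⟩ := hE.exists_ball_flat hEo hx (half_pos hη0)
  obtain ⟨r3, hr3, H3⟩ := hE.exists_ball_gradNormal hEo hx (half_pos hη0)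
  obtain ⟨r4, hr4, H4⟩ := Metric.continuousWithinAt_iff.1 (hE.continuousOn_outerNormal hEo x hx)
    (η / 2) (half_pos hη0)
  set r5 := η / 2 / (‖M‖ + 1) with hr5
  set r := min r1 (min r2 (min r3 (min r4 (min r5 1)))) with hrdef
  have hr5p : 0 < r5 := by positivity
  refine ⟨r, by positivity, ?_⟩
  have h1 : r ≤ r1 := min_le_left _ _
  have h1' : r ≤ min r2 (min r3 (min r4 (min r5 1))) := min_le_right _ _
  have h2 : r ≤ r2 := h1'.trans (min_le_left _ _)
  have h2' := h1'.trans (min_le_right _ _)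
  have h3 : r ≤ r3 := h2'.trans (min_le_left _ _)
  have h3' := h2'.trans (min_le_right _ _)
  have h4 : r ≤ r4 := h3'.trans (min_le_left _ _)
  have h4' := h3'.trans (min_le_right _ _)
  have h5 : r ≤ r5 := h4'.trans (min_le_left _ _)
  have h6 : r ≤ 1 := h4'.trans (min_le_right _ _)
  rintro ⟨y, s⟩ ⟨hy, hs⟩ ⟨y', s'⟩ ⟨hy', hs'⟩
  simp only at hy hs hy' hs'
  rw [flatMap_sub]
  have hρ := norm_flatMap_sq hn ((y, s) - (y', s'))
  set ρ := ‖flatMap E x ((y, s) - (y', s'))‖ with hρdef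
  have hρ0 : 0 ≤ ρ := norm_nonneg _
  simp only [Prod.mk_sub_mk] at hρ
  set h := y - y' with hh
  set k := s - s' with hk
  have mono : ∀ {a b : ℝ}, a ≤ b → ∀ {w}, w ∈ frontier E ∩ ball x a →
    w ∈ frontier E ∩ ball x b := fun hab w hw => ⟨hw.1, ball_subset_ball hab hw.2⟩
  have b1 := H1 y (mono h1 hy) y' (mono h1 hy')
  have b2 := H2 y (mono h2 hy) y' (mono h2 hy')
  have b3 := H3 y (mono h3 hy) y' (mono h3 hy')
  have b4 := H4 hy'.1 (ball_subset_ball h4 hy'.2)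
  rw [dist_eq_norm] at b4
  rw [← hh] at b1 b2 b3
  have c1 : ‖tangentProj E x h‖ ≤ ρ := by
    rw [← sq_le_sq₀ (norm_nonneg _) hρ0, hρ]; nlinarith [sq_nonneg k]
  have c2 : |k| ≤ ρ := by
    rw [← sq_le_sq₀ (abs_nonneg _) hρ0, hρ, sq_abs]; nlinarith [sq_nonneg ‖tangentProj E x h‖]
  have c3 : ‖h‖ ≤ 2 * ρ := by linarith
  have c4 : |s - s₀| ≤ r := by rw [mem_ball, Real.dist_eq] at hs; exact hs.le
  have c5 : |s| ≤ |s₀| + 1 := by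
    have := abs_add_le (s - s₀) s₀
    rw [sub_add_cancel] at this
    linarith
  have e : normalMap E (y, s) - normalMap E (y', s') -
      normalDeriv E (x, s₀) (flatMap E x ((y, s) - (y', s'))) =
      ⟪outerNormal E x, h⟫_ℝ • outerNormal E x +
      s • (outerNormal E y - outerNormal E y' - M h) + (s - s₀) • M h +
      k • (outerNormal E y' - outerNormal E x) :=
    normalMap_sub_sub hn s₀ y y' s s'
  rw [e]
  have t1 : ‖⟪outerNormal E x, h⟫_ℝ • outerNormal E x‖ ≤ η * ρ := by
    rw [norm_smul, hn, mul_one, Real.norm_eq_abs]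
    nlinarith
  have t2 : ‖s • (outerNormal E y - outerNormal E y' - M h)‖ ≤ (|s₀| + 1) * (η * ρ) := by
    rw [norm_smul, Real.norm_eq_abs]
    gcongr
    nlinarith
  have t3 : ‖(s - s₀) • M h‖ ≤ η * ρ := by
    rw [norm_smul, Real.norm_eq_abs]
    have g1 : ‖M h‖ ≤ (‖M‖ + 1) * (2 * ρ) := (M.le_opNorm h).trans (by gcongr; linarith)
    calc |s - s₀| * ‖M h‖ ≤ r5 * ((‖M‖ + 1) * (2 * ρ)) := by
          gcongr; exact c4.trans h5
      _ = η * ρ := by rw [hr5]; field_simp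
  have t4 : ‖k • (outerNormal E y' - outerNormal E x)‖ ≤ ρ * η := by
    rw [norm_smul, Real.norm_eq_abs]
    gcongr
    linarith
  calc _ ≤ η * ρ + (|s₀| + 1) * (η * ρ) + η * ρ + ρ * η :=
        (norm_add_le _ _).trans (add_le_add ((norm_add_le _ _).trans (add_le_add
          ((norm_add_le _ _).trans (add_le_add t1 t2)) t3)) t4)
    _ = (η * (4 + |s₀|)) * ρ := by ring
    _ ≤ (η * (5 + 2 * |s₀|)) * ρ := by
        have : 4 + |s₀| ≤ 5 + 2 * |s₀| := by linarith [abs_nonneg s₀]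
        gcongr
    _ = δ * ρ := by rw [hη]; field_simp

/-- Near `(x, s₀)` the normal coordinates factor through the linearized ones by a map close to the
Jacobian. -/
theorem IsC2Set.exists_approximatesLinearOn (hEo : IsOpen E) (hE : IsC2Set E)
    (hx : x ∈ frontier E) (s₀ : ℝ) {δ : ℝ≥0} (hδ : 0 < δ) :
    ∃ U ∈ 𝓝 (x, s₀), ∀ B ⊆ (frontier E ×ˢ univ) ∩ U, ∃ G : Euc d → Euc d,
      ApproximatesLinearOn G (normalDeriv E (x, s₀)) (flatMap E x '' B) δ ∧
      G '' (flatMap E x '' B) = normalMap E '' B := by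
  have hn := hE.norm_outerNormal hx
  obtain ⟨r1, hr1, H1⟩ := hE.exists_normalMap_approx hEo hx s₀ (δ := δ) hδ
  obtain ⟨r2, hr2, H2⟩ := hE.exists_ball_proj hEo hx (K := 2) (by norm_num)
  refine ⟨ball x (min r1 r2) ×ˢ ball s₀ r1, prod_mem_nhds (ball_mem_nhds _ (by positivity))
    (ball_mem_nhds _ hr1), fun B hB => ?_⟩
  have hB1 : B ⊆ (frontier E ∩ ball x r1) ×ˢ ball s₀ r1 := fun z hz =>
    ⟨⟨(hB hz).1.1, ball_subset_ball (min_le_left _ _) (hB hz).2.1⟩, (hB hz).2.2⟩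
  have hB2 : B ⊆ (frontier E ∩ ball x r2) ×ˢ univ := fun z hz =>
    ⟨⟨(hB hz).1.1, ball_subset_ball (min_le_right _ _) (hB hz).2.1⟩, mem_univ _⟩
  have hinj : InjOn (flatMap E x) B := (injOn_flatMap hn H2).mono hB2
  set i := Function.invFunOn (flatMap E x) B
  have hi : ∀ z ∈ B, i (flatMap E x z) = z := fun z hz => hinj.leftInvOn_invFunOn hz
  refine ⟨fun a => normalMap E (i a), ?_, ?_⟩
  · rw [ApproximatesLinearOn.approximatesLinearOn_iff_lipschitzOnWith]
    refine LipschitzOnWith.of_dist_le_mul ?_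
    rintro _ ⟨z, hz, rfl⟩ _ ⟨z', hz', rfl⟩
    rw [dist_eq_norm, dist_eq_norm]
    simp only [Pi.sub_apply, hi z hz, hi z' hz']
    have h := H1 z (hB1 hz) z' (hB1 hz')
    rw [map_sub] at h
    refine (le_of_eq ?_).trans h
    congr 1
    abel
  · rw [image_image]
    exact image_congr fun z hz => by rw [hi z hz]

/-- Upper half of the local area formula: the almost linear factor multiplies volume by at most m,
and the flat image has volume at most the product measure. -/
theorem IsC2Set.exists_nhds_volume_le [SFinite (boundaryMeasure E)] (hEo : IsOpen E)
    (hE : IsC2Set E) (hx : x ∈ frontier E) (s₀ : ℝ) {m : ℝ≥0}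
    (hm : ENNReal.ofReal |(normalDeriv E (x, s₀)).det| < m) :
    ∃ U ∈ 𝓝 (x, s₀), ∀ B ⊆ (frontier E ×ˢ univ) ∩ U, MeasurableSet B →
      volume (normalMap E '' B) ≤ m * (boundaryMeasure E).prod volume B := by
  obtain ⟨δ, hδ, hδ0⟩ := ((addHaar_image_le_mul_of_det_lt (volume : Measure (Euc d))
    (normalDeriv E (x, s₀)) hm).and self_mem_nhdsWithin).exists
  obtain ⟨U, hU, HU⟩ := hE.exists_approximatesLinearOn hEo hx s₀ hδ0
  obtain ⟨r, hr0, hr⟩ := hE.exists_ball_proj hEo hx (K := (2 : ℝ≥0)) (by norm_num)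
  refine ⟨U ∩ ball x r ×ˢ univ, inter_mem hU (prod_mem_nhds (ball_mem_nhds _ hr0) univ_mem),
    fun B hB hBm => ?_⟩
  obtain ⟨G, hG, hGi⟩ := HU B fun z hz => ⟨(hB hz).1, (hB hz).2.1⟩
  have h1 := hδ _ G hG
  rw [hGi] at h1
  have h2 := (volume_flatMap_image_bounds (hE.norm_outerNormal hx) hr hBm
    fun z hz => ⟨⟨(hB hz).1.1, (hB hz).2.2.1⟩, mem_univ _⟩).1
  exact h1.trans (mul_le_mul_right h2 _)

theorem IsC2Set.exists_nhds_le_volume [SFinite (boundaryMeasure E)] (hEo : IsOpen E)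
    (hE : IsC2Set E) (hx : x ∈ frontier E) (s₀ : ℝ) {m : ℝ≥0}
    (hm : (m : ℝ≥0∞) < ENNReal.ofReal |(normalDeriv E (x, s₀)).det|) :
    ∃ U ∈ 𝓝 (x, s₀), ∀ B ⊆ (frontier E ×ˢ univ) ∩ U, MeasurableSet B →
      m * (boundaryMeasure E).prod volume B ≤ volume (normalMap E '' B) := by
  -- Passing from the product measure to the volume of the flat image loses a factor K^(d-1), so K
  -- is chosen close enough to 1 to keep m K^(d-1) below the Jacobian.
  obtain ⟨K, hK1, hK⟩ : ∃ K : ℝ≥0, 1 < K ∧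
      ((m * K ^ (d - 1) : ℝ≥0) : ℝ≥0∞) < ENNReal.ofReal |(normalDeriv E (x, s₀)).det| := by
    have hc : Tendsto (fun K : ℝ≥0 => ((m * K ^ (d - 1) : ℝ≥0) : ℝ≥0∞)) (𝓝[>] 1)
        (𝓝 ((m * 1 ^ (d - 1) : ℝ≥0) : ℝ≥0∞)) := by
      have : Continuous fun K : ℝ≥0 => ((m * K ^ (d - 1) : ℝ≥0) : ℝ≥0∞) :=
        ENNReal.continuous_coe.comp (by fun_prop)
      exact (this.tendsto 1).mono_left nhdsWithin_le_nhds
    rw [one_pow, mul_one] at hc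
    obtain ⟨K, h1, h2⟩ := ((hc.eventually (gt_mem_nhds hm)).and self_mem_nhdsWithin).exists
    exact ⟨K, h2, h1⟩
  obtain ⟨δ, hδ, hδ0⟩ := ((mul_le_addHaar_image_of_lt_det (volume : Measure (Euc d))
    (normalDeriv E (x, s₀)) hK).and self_mem_nhdsWithin).exists
  obtain ⟨U, hU, HU⟩ := hE.exists_approximatesLinearOn hEo hx s₀ hδ0
  obtain ⟨r, hr0, hr⟩ := hE.exists_ball_proj hEo hx (K := K) (by exact_mod_cast hK1)
  refine ⟨U ∩ ball x r ×ˢ univ, inter_mem hU (prod_mem_nhds (ball_mem_nhds _ hr0) univ_mem),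
    fun B hB hBm => ?_⟩
  obtain ⟨G, hG, hGi⟩ := HU B fun z hz => ⟨(hB hz).1, (hB hz).2.1⟩
  have h1 := hδ _ G hG
  rw [hGi] at h1
  have h2 := (volume_flatMap_image_bounds (hE.norm_outerNormal hx) hr hBm
    fun z hz => ⟨⟨(hB hz).1.1, (hB hz).2.2.1⟩, mem_univ _⟩).2
  refine (mul_le_mul_right h2 _).trans (le_trans (le_of_eq ?_) h1)
  push_cast
  ring

/-- Only the local upper bound is needed, so neither injectivity nor contact enters. This is what
discards the exceptional normal coordinates. -/
theorem IsC2Set.volume_image_eq_zero [SFinite (boundaryMeasure E)] (hEo : IsOpen E)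
    (hE : IsC2Set E) {A : Set (Euc d × ℝ)} (hA : MeasurableSet A) (hAE : A ⊆ frontier E ×ˢ univ)
    (h0 : (boundaryMeasure E).prod volume A = 0) : volume (normalMap E '' A) = 0 := by
  have hloc : ∀ z ∈ A, ∃ U ∈ 𝓝 z, ∀ B ⊆ A ∩ U, MeasurableSet B →
      volume (normalMap E '' B) = 0 := by
    rintro ⟨x, s⟩ hz
    obtain ⟨m, hm⟩ := ENNReal.lt_iff_exists_nnreal_btwn.1
      (ENNReal.ofReal_lt_top (r := |(normalDeriv E (x, s)).det|))
    obtain ⟨U, hU, H⟩ := hE.exists_nhds_volume_le hEo (hAE hz).1 s hm.1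
    refine ⟨U, hU, fun B hB hBm => ?_⟩
    have := H B (fun w hw => ⟨hAE (hB hw).1, (hB hw).2⟩) hBm
    rw [measure_mono_null (hB.trans inter_subset_left) h0, mul_zero] at this
    exact le_antisymm this zero_le
  choose! U hU1 hU2 using hloc
  obtain ⟨B, hBm, -, hBA, hB⟩ := exists_measurable_partition_of_nhds hA U hU1
  rw [← hBA, image_iUnion, measure_iUnion_null_iff]
  intro n
  rcases hB n with h | ⟨z, hz, hz'⟩
  · simp [h]
  · exact hU2 z hz _ hz' (hBm n)

theorem IsC2Set.continuousOn_normalDeriv (hEo : IsOpen E) (hE : IsC2Set E) :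
    ContinuousOn (normalDeriv E) (frontier E ×ˢ univ) :=
  continuousOn_const.add (continuousOn_snd.smul
    ((hE.continuousOn_gradNormal hEo).comp continuousOn_fst fun _ hz => hz.1))

/-- Change of variables in normal coordinates. -/
theorem IsC2Set.volume_image_eq [SFinite (boundaryMeasure E)] (hEo : IsOpen E)
    (hE : IsC2Set E) {A : Set (Euc d × ℝ)} (hA : MeasurableSet A) (hAW : A ⊆ strictContactSet E)
    (hfin : (boundaryMeasure E).prod volume A ≠ ∞) :
    volume (normalMap E '' A) = ∫⁻ z in A, ENNReal.ofReal (normalDeriv E z).det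
      ∂(boundaryMeasure E).prod volume := by
  have hAE : A ⊆ frontier E ×ˢ univ := fun z hz => ⟨(strictContactSet_subset (hAW hz)).1, trivial⟩
  have hinj : InjOn (normalMap E) A := hE.injOn_normalMap.mono hAW
  have hcont : ContinuousOn (normalMap E) A := (hE.continuousOn_normalMap hEo).mono hAE
  have hD : ∀ z ∈ A, ENNReal.ofReal (normalDeriv E z).det =
      ((|(normalDeriv E z).det|.toNNReal : ℝ≥0) : ℝ≥0∞) := by
    intro z hz
    have : 0 ≤ (normalDeriv E z).det := hE.det_nonneg hEo (strictContactSet_subset (hAW hz))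
    change ENNReal.ofReal _ = ENNReal.ofReal |(normalDeriv E z).det|
    rw [abs_of_nonneg this]
  rw [setLIntegral_congr_fun hA hD]
  refine eq_setLIntegral_of_local (ν := fun B => volume (normalMap E '' B)) hA hfin (by simp)
    ?_ ?_
  · intro B hBm hBA hBd
    rw [image_iUnion, measure_iUnion]
    · intro i j hij
      exact (hBd hij).image hinj (hBA i) (hBA j)
    · exact fun n => (hBm n).image_of_continuousOn_injOn (hcont.mono (hBA n)) (hinj.mono (hBA n))
  · rintro η hη ⟨x, s⟩ hz
    set J : Euc d × ℝ → ℝ≥0 := fun z => |(normalDeriv E z).det|.toNNReal with hJ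
    have hJc : ContinuousWithinAt J (frontier E ×ˢ univ) (x, s) :=
      (continuous_real_toNNReal.comp
        (continuous_abs.comp ContinuousLinearMap.continuous_det)).continuousAt
          |>.comp_continuousWithinAt (hE.continuousOn_normalDeriv hEo _ (hAE hz))
    -- One half of η pays for the volume estimate with the Jacobian frozen at the centre, the other
    -- for the variation of the Jacobian over the neighbourhood.
    have hη2 : 0 < η / 2 := half_pos hη
    have e1 : ∀ᶠ w in 𝓝[frontier E ×ˢ univ] (x, s), J w < J (x, s) + η / 2 :=
      hJc.eventually (gt_mem_nhds (lt_add_of_pos_right _ hη2))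
    have e2 : ∀ᶠ w in 𝓝[frontier E ×ˢ univ] (x, s), J (x, s) < J w + η / 2 :=
      (hJc.add_const (η / 2)).eventually (lt_mem_nhds (lt_add_of_pos_right _ hη2))
    obtain ⟨U0, hU0, H0⟩ := mem_nhdsWithin_iff_exists_mem_nhds_inter.1 (e1.and e2)
    obtain ⟨U1, hU1, H1⟩ := hE.exists_nhds_volume_le hEo (hAE hz).1 s (m := J (x, s) + η / 2) (by
      change ((J (x, s) : ℝ≥0) : ℝ≥0∞) < _
      exact_mod_cast lt_add_of_pos_right _ hη2)
    obtain ⟨U2, hU2, H2⟩ : ∃ U ∈ 𝓝 (x, s), ∀ B ⊆ (frontier E ×ˢ univ) ∩ U, MeasurableSet B →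
        ((J (x, s) - η / 2 : ℝ≥0) : ℝ≥0∞) * (boundaryMeasure E).prod volume B ≤
          volume (normalMap E '' B) := by
      -- Where the Jacobian vanishes the truncated difference is 0 and the lower bound is trivial;
      -- elsewhere J - η/2 is strictly below J, as the local lower bound requires.
      rcases eq_or_lt_of_le (zero_le (a := J (x, s))) with h0 | h0
      · exact ⟨univ, univ_mem, fun B _ _ => by rw [← h0]; simp⟩
      · refine hE.exists_nhds_le_volume hEo (hAE hz).1 s ?_
        change _ < ((J (x, s) : ℝ≥0) : ℝ≥0∞)
        exact_mod_cast tsub_lt_self h0 hη2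
    refine ⟨U0 ∩ (U1 ∩ U2), inter_mem hU0 (inter_mem hU1 hU2), fun B hB hBm => ?_⟩
    have hBE : ∀ w ∈ B, w ∈ frontier E ×ˢ univ := fun w hw => hAE (hB hw).1
    have f1 := H1 B (fun w hw => ⟨hBE w hw, (hB hw).2.2.1⟩) hBm
    have f2 := H2 B (fun w hw => ⟨hBE w hw, (hB hw).2.2.2⟩) hBm
    have f0 : ∀ w ∈ B, J w < J (x, s) + η / 2 ∧ J (x, s) < J w + η / 2 :=
      fun w hw => H0 ⟨(hB hw).2.1, hBE w hw⟩
    set Λ := (boundaryMeasure E).prod (volume : Measure ℝ)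
    have hη' : ((η / 2 : ℝ≥0) : ℝ≥0∞) + ((η / 2 : ℝ≥0) : ℝ≥0∞) = η := by
      rw [← ENNReal.coe_add, add_halves]
    constructor
    · have g1 : (J (x, s) : ℝ≥0∞) * Λ B ≤
          ∫⁻ w in B, (J w : ℝ≥0∞) ∂Λ + ((η / 2 : ℝ≥0) : ℝ≥0∞) * Λ B := by
        rw [← setLIntegral_const, ← setLIntegral_const, ← lintegral_add_right _ measurable_const]
        exact setLIntegral_mono' hBm fun w hw => by exact_mod_cast (f0 w hw).2.le
      calc volume (normalMap E '' B)
          ≤ (J (x, s) : ℝ≥0∞) * Λ B + ((η / 2 : ℝ≥0) : ℝ≥0∞) * Λ B := by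
            rw [← add_mul, ← ENNReal.coe_add]; exact f1
        _ ≤ _ := add_le_add_left g1 _
        _ = _ := by rw [add_assoc, ← add_mul, hη']
    · have g1 : ∫⁻ w in B, (J w : ℝ≥0∞) ∂Λ ≤
          (J (x, s) : ℝ≥0∞) * Λ B + ((η / 2 : ℝ≥0) : ℝ≥0∞) * Λ B := by
        rw [← add_mul, ← setLIntegral_const]
        exact setLIntegral_mono' hBm fun w hw => by exact_mod_cast (f0 w hw).1.le
      have g2 : (J (x, s) : ℝ≥0∞) ≤ ((J (x, s) - η / 2 : ℝ≥0) : ℝ≥0∞) +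
          ((η / 2 : ℝ≥0) : ℝ≥0∞) := by
        exact_mod_cast le_tsub_add
      calc _ ≤ _ := g1
        _ ≤ (((J (x, s) - η / 2 : ℝ≥0) : ℝ≥0∞) + ((η / 2 : ℝ≥0) : ℝ≥0∞)) * Λ B +
            ((η / 2 : ℝ≥0) : ℝ≥0∞) * Λ B := by gcongr
        _ = ((J (x, s) - η / 2 : ℝ≥0) : ℝ≥0∞) * Λ B + η * Λ B := by
            rw [← hη']; ring
        _ ≤ _ := add_le_add_left f2 _

end Area

/-- The normal perturbation `{x + ε φ(x) ν_E(x) : x ∈ ∂E}` of the boundary. -/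
def normalGraph {d : ℕ} (E : Set (Euc d)) (φ : Euc d → ℝ) (ε : ℝ) : Set (Euc d) :=
  (fun x => x + (ε * φ x) • outerNormal E x) '' frontier E

/-! ### First variation of the distance under normal perturbations. -/

section Danskin

variable {d : ℕ} {E : Set (Euc d)} {φ : Euc d → ℝ}

theorem isCompact_frontier_of_isBounded (hEb : Bornology.IsBounded E) : IsCompact (frontier E) :=
  hEb.isCompact_closure.of_isClosed_subset isClosed_frontier frontier_subset_closure

theorem normalGraph_zero : normalGraph E φ 0 = frontier E := by
  simp [normalGraph]

theorem IsC2OnFrontier.continuousOn (hφ : IsC2OnFrontier E φ) : ContinuousOn φ (frontier E) := by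
  intro x hx
  obtain ⟨ψ, hψ, hψe⟩ := hφ x hx
  exact hψ.continuousAt.continuousWithinAt.congr_of_eventuallyEq hψe (hψe.self_of_nhdsWithin hx)

theorem IsC2Set.isCompact_normalGraph (hEo : IsOpen E) (hE : IsC2Set E)
    (hEb : Bornology.IsBounded E) (hφ : ContinuousOn φ (frontier E)) (ε : ℝ) :
    IsCompact (normalGraph E φ ε) :=
  (isCompact_frontier_of_isBounded hEb).image_of_continuousOn
    (continuousOn_id.add ((continuousOn_const.mul hφ).smul (hE.continuousOn_outerNormal hEo)))

theorem IsC2Set.infDist_normalGraph_le (hEo : IsOpen E) (hE : IsC2Set E)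
    (hEb : Bornology.IsBounded E) (hne : (frontier E).Nonempty)
    (hφ : ContinuousOn φ (frontier E)) {M : ℝ} (hM : ∀ x ∈ frontier E, |φ x| ≤ M)
    (y : Euc d) (ε ε' : ℝ) :
    infDist y (normalGraph E φ ε) ≤ infDist y (normalGraph E φ ε') + M * |ε - ε'| := by
  obtain ⟨_, ⟨x, hx, rfl⟩, h⟩ := (hE.isCompact_normalGraph hEo hEb hφ ε').exists_infDist_eq_dist
    (hne.image _) y
  rw [h]
  have hmem : x + (ε * φ x) • outerNormal E x ∈ normalGraph E φ ε := ⟨x, hx, rfl⟩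
  refine (infDist_le_dist_of_mem hmem).trans ((dist_triangle _
    (x + (ε' * φ x) • outerNormal E x) _).trans (add_le_add_right ?_ _))
  rw [dist_add_left, dist_eq_norm, ← sub_smul, norm_smul, hE.norm_outerNormal hx, mul_one,
    Real.norm_eq_abs, ← sub_mul, abs_mul, abs_sub_comm, mul_comm]
  exact mul_le_mul_of_nonneg_right (hM x hx) (abs_nonneg _)

theorem IsC2Set.abs_infDist_normalGraph_sub_le (hEo : IsOpen E) (hE : IsC2Set E)
    (hEb : Bornology.IsBounded E) (hne : (frontier E).Nonempty)
    (hφ : ContinuousOn φ (frontier E)) {M : ℝ} (hM : ∀ x ∈ frontier E, |φ x| ≤ M)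
    (y : Euc d) (ε ε' : ℝ) :
    |infDist y (normalGraph E φ ε) - infDist y (normalGraph E φ ε')| ≤ M * |ε - ε'| := by
  have h1 := hE.infDist_normalGraph_le hEo hEb hne hφ hM y ε ε'
  have h2 := hE.infDist_normalGraph_le hEo hEb hne hφ hM y ε' ε
  rw [abs_sub_comm ε' ε] at h2
  rw [abs_le]
  constructor <;> linarith

/-- First variation of the squared distance at a point with a nondegenerate nearest point. -/
theorem IsC2Set.hasDerivAt_infDist_sq (hEo : IsOpen E) (hE : IsC2Set E)
    (hEb : Bornology.IsBounded E) (hφ : ContinuousOn φ (frontier E)) {x : Euc d} {s : ℝ}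
    (h : (x, s) ∈ strictContactSet E) :
    HasDerivAt (fun ε => infDist (normalMap E (x, s)) (normalGraph E φ ε) ^ 2)
      (-2 * s * φ x) 0 := by
  have hcon := strictContactSet_subset h
  obtain ⟨c, hc1, hc⟩ := h
  have hx := hcon.1
  simp only at hx
  have hn := hE.norm_outerNormal hx
  have hcomp := isCompact_frontier_of_isBounded hEb
  set y := normalMap E (x, s) with hy
  set k : Euc d → ℝ := fun w => φ w * ⟪y - w, outerNormal E w⟫_ℝ with hk
  have hν := hE.continuousOn_outerNormal hEo
  have hkc : ContinuousOn k (frontier E) :=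
    hφ.mul ((continuousOn_const.sub continuousOn_id).inner hν)
  have hkx : k x = s * φ x := by
    have : y - x = s • outerNormal E x := by rw [hy, normalMap, add_sub_cancel_left]
    simp only [hk, this, real_inner_smul_left, real_inner_self_eq_norm_sq, hn]
    ring
  obtain ⟨C, hC⟩ := hcomp.exists_bound_of_continuousOn hkc
  have hC0 : 0 ≤ C := (norm_nonneg _).trans (hC x hx)
  have hexp : ∀ ε, ∀ w ∈ frontier E, dist y (w + (ε * φ w) • outerNormal E w) ^ 2 =
      ‖y - w‖ ^ 2 - 2 * ε * k w + (ε * φ w) ^ 2 := by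
    intro ε w hw
    have e : y - (w + (ε * φ w) • outerNormal E w) = (y - w) - (ε * φ w) • outerNormal E w := by
      abel
    rw [dist_eq_norm, e, norm_sub_sq_real, norm_smul, hE.norm_outerNormal hw, mul_one,
      Real.norm_eq_abs, sq_abs, real_inner_smul_right]
    simp only [hk]
    ring
  set κ := 1 - c⁻¹ with hκ
  have hκ0 : 0 < κ := by rw [hκ, sub_pos]; exact inv_lt_one_of_one_lt₀ hc1
  -- Contact at cs uses up only the fraction 1/c of ‖w - x‖² in the contact inequality at s; the
  -- remaining fraction κ = 1 - 1/c is quadratic growth at the nearest point.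
  have hgrow : ∀ w ∈ frontier E, s ^ 2 + κ * ‖w - x‖ ^ 2 ≤ ‖y - w‖ ^ 2 := by
    intro w hw
    rw [hy, norm_normalMap_sub_sq hn]
    have h1 := hc.2 w hw
    simp only at h1
    have hc0 : 0 < c := by linarith
    have h2 : 2 * s * ⟪w - x, outerNormal E x⟫_ℝ ≤ c⁻¹ * ‖w - x‖ ^ 2 := by
      rw [inv_mul_eq_div, le_div_iff₀ hc0]
      linarith
    rw [hκ]
    linarith
  have hyx : ‖y - x‖ ^ 2 = s ^ 2 := by
    rw [← dist_eq_norm, hy, hE.dist_normalMap hx, sq_abs]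
  have h00 : infDist y (normalGraph E φ 0) ^ 2 = s ^ 2 := by
    rw [normalGraph_zero, hy, hE.infDist_normalMap hcon, sq_abs]
  rw [hasDerivAt_iff_isLittleO_nhds_zero, Asymptotics.isLittleO_iff]
  intro η hη
  obtain ⟨r, hr0, hr⟩ := Metric.continuousWithinAt_iff.1 (hkc x hx) (η / 2) (half_pos hη)
  have e1 : ∀ᶠ ε : ℝ in 𝓝 0, 4 * |ε| * C < κ * r ^ 2 := by
    have : Tendsto (fun ε : ℝ => 4 * |ε| * C) (𝓝 0) (𝓝 (4 * |0| * C)) := by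
      exact Continuous.tendsto (by fun_prop) 0
    rw [abs_zero, mul_zero, zero_mul] at this
    exact this.eventually (gt_mem_nhds (by positivity))
  have e2 : ∀ᶠ ε : ℝ in 𝓝 0, |ε| * φ x ^ 2 < η := by
    have : Tendsto (fun ε : ℝ => |ε| * φ x ^ 2) (𝓝 0) (𝓝 (|0| * φ x ^ 2)) := by
      exact Continuous.tendsto (by fun_prop) 0
    rw [abs_zero, zero_mul] at this
    exact this.eventually (gt_mem_nhds hη)
  filter_upwards [e1, e2] with ε h1 h2
  rw [zero_add, h00, Real.norm_eq_abs, Real.norm_eq_abs, smul_eq_mul, abs_le]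
  have hεa := neg_abs_le ε
  have hεb := le_abs_self ε
  constructor
  · obtain ⟨_, ⟨w, hw, rfl⟩, hwd⟩ := (hE.isCompact_normalGraph hEo hEb hφ ε).exists_infDist_eq_dist
      (Nonempty.image _ ⟨x, hx⟩) y
    simp only at hwd
    rw [hwd, hexp ε w hw]
    have g1 := hgrow w hw
    have g2 := sq_nonneg (ε * φ w)
    -- Within distance r of x the function k varies by less than η/2. Farther away its variation is
    -- at most 2C, and the growth κ r² exceeds 4|ε|C for small ε.
    have g3 : 2 * ε * k w - 2 * ε * k x ≤ |ε| * η + κ * ‖w - x‖ ^ 2 := by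
      have e : 2 * ε * k w - 2 * ε * k x = 2 * (ε * (k w - k x)) := by ring
      rw [e]
      have g4 : ε * (k w - k x) ≤ |ε| * |k w - k x| := by rw [← abs_mul]; exact le_abs_self _
      rcases lt_or_ge (dist w x) r with hlt | hge
      · have g5 := hr hw hlt
        rw [Real.dist_eq] at g5
        have g6 : |ε| * |k w - k x| ≤ |ε| * (η / 2) := by gcongr
        have g7 : 0 ≤ κ * ‖w - x‖ ^ 2 := by positivity
        linarith
      · have g5 : |k w - k x| ≤ C + C := (abs_sub _ _).trans (add_le_add (hC w hw) (hC x hx))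
        have g6 : |ε| * |k w - k x| ≤ |ε| * (C + C) := by gcongr
        rw [dist_eq_norm] at hge
        have g7 : κ * r ^ 2 ≤ κ * ‖w - x‖ ^ 2 := by gcongr
        have g8 : 0 ≤ |ε| * η := by positivity
        linarith
    rw [hkx] at g3
    linarith
  · have g1 : infDist y (normalGraph E φ ε) ^ 2 ≤
        dist y (x + (ε * φ x) • outerNormal E x) ^ 2 := by
      gcongr
      · exact infDist_nonneg
      · exact infDist_le_dist_of_mem ⟨x, hx, rfl⟩
    rw [hexp ε x hx, hyx, hkx] at g1
    have g2 : (ε * φ x) ^ 2 ≤ η * |ε| := by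
      have : (ε * φ x) ^ 2 = |ε| * (|ε| * φ x ^ 2) := by rw [← mul_assoc, abs_mul_abs_self]; ring
      rw [this]
      nlinarith [abs_nonneg ε]
    linarith

theorem IsC2Set.hasDerivAt_infDist (hEo : IsOpen E) (hE : IsC2Set E)
    (hEb : Bornology.IsBounded E) (hφ : ContinuousOn φ (frontier E)) {x : Euc d} {s : ℝ}
    (h : (x, s) ∈ strictContactSet E) (hs : s ≠ 0) :
    HasDerivAt (fun ε => infDist (normalMap E (x, s)) (normalGraph E φ ε))
      (-(s / |s|) * φ x) 0 := by
  have h0 : infDist (normalMap E (x, s)) (normalGraph E φ 0) = |s| := by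
    rw [normalGraph_zero, hE.infDist_normalMap (strictContactSet_subset h)]
  have h1 := (hE.hasDerivAt_infDist_sq hEo hEb hφ h).sqrt (by rw [h0]; positivity)
  simp only [Real.sqrt_sq infDist_nonneg, h0] at h1
  refine h1.congr_deriv ?_
  have := abs_pos.2 hs
  rw [Real.sqrt_sq this.le]
  field_simp

/-- For s < 0 the derivative of the distance changes sign, and so does f' when evaluated at -s
instead of s. The two signs cancel, giving one formula for both sides of the boundary. -/
theorem IsC2Set.hasDerivAt_comp_infDist (hEo : IsOpen E) (hE : IsC2Set E)
    (hEb : Bornology.IsBounded E) (hφ : ContinuousOn φ (frontier E)) {f : ℝ → ℝ}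
    (hf : ∀ s, f (-s) = f s) {x : Euc d} {s : ℝ}
    (h : (x, s) ∈ strictContactSet E) (hs : s ≠ 0) (hd : DifferentiableAt ℝ f s) :
    HasDerivAt (fun ε => f (infDist (normalMap E (x, s)) (normalGraph E φ ε)))
      (-deriv f s * φ x) 0 := by
  have h0 : infDist (normalMap E (x, s)) (normalGraph E φ 0) = |s| := by
    rw [normalGraph_zero, hE.infDist_normalMap (strictContactSet_subset h)]
  have h1 := hE.hasDerivAt_infDist hEo hEb hφ h hs
  rcases hs.lt_or_gt with hneg | hpos
  · have h2 : HasDerivAt f (-deriv f s) (-s) := by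
      have e : f = fun t => f (-t) := funext fun t => (hf t).symm
      have h3 : HasDerivAt f (deriv f s) (-(-s)) := by rw [neg_neg]; exact hd.hasDerivAt
      have h4 := h3.comp (-s) (hasDerivAt_neg (-s))
      have h5 : HasDerivAt (fun t => f (-t)) (-deriv f s) (-s) := h4.congr_deriv (by ring)
      rwa [← e] at h5
    rw [abs_of_neg hneg] at h0 h1
    rw [← h0] at h2
    refine (h2.comp (0 : ℝ) h1).congr_deriv ?_
    field_simp
  · have h2 : HasDerivAt f (deriv f s) s := hd.hasDerivAt
    rw [abs_of_pos hpos] at h0 h1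
    rw [← h0] at h2
    refine (h2.comp (0 : ℝ) h1).congr_deriv ?_
    rw [h0]
    field_simp

end Danskin

/-- The pairs in the strict contact set at distance at most `ρ₀`, where `f` is differentiable. -/
def regularSet {d : ℕ} (E : Set (Euc d)) (f : ℝ → ℝ) (ρ₀ : ℝ) : Set (Euc d × ℝ) :=
  {z | z ∈ strictContactSet E ∧ |z.2| ≤ ρ₀ ∧ z.2 ≠ 0 ∧ DifferentiableAt ℝ f z.2}

theorem integrable_comp_infDist {d : ℕ} {f : ℝ → ℝ} (hf : Continuous f) {ρ₀ : ℝ}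
    (h0 : ∀ s, ρ₀ < s → f s = 0) {K : Set (Euc d)} (hK : IsCompact K) (hne : K.Nonempty) :
    Integrable fun y => f (infDist y K) := by
  refine (hf.comp (continuous_infDist_pt K)).integrable_of_hasCompactSupport ?_
  refine HasCompactSupport.intro' (K := cthickening ρ₀ K) hK.cthickening isClosed_cthickening ?_
  intro y hy
  rw [Function.comp_apply]
  refine h0 _ ?_
  by_contra! hc
  obtain ⟨w, hw, hwd⟩ := hK.exists_infDist_eq_dist hne y
  exact hy (mem_cthickening_of_dist_le y w _ _ hw (hwd ▸ hc))

/-! ### Transport of integrals to normal coordinates. -/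

section Transport

variable {d : ℕ} {E : Set (Euc d)}

theorem IsC2Set.measurable_outerNormal (hEo : IsOpen E) (hE : IsC2Set E) :
    Measurable (outerNormal E) := by
  classical
  have e : outerNormal E = (frontier E).piecewise (outerNormal E) (fun _ => 0) := by
    ext1 x
    by_cases hx : x ∈ frontier E
    · rw [piecewise_eq_of_mem _ _ _ hx]
    · rw [piecewise_eq_of_notMem _ _ _ hx, outerNormal_of_notMem_frontier hx]
  rw [e]
  exact (hE.continuousOn_outerNormal hEo).measurable_piecewise continuousOn_const
    isClosed_frontier.measurableSet

theorem IsC2Set.measurable_normalMap (hEo : IsOpen E) (hE : IsC2Set E) :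
    Measurable (normalMap E) :=
  measurable_fst.add (measurable_snd.smul ((hE.measurable_outerNormal hEo).comp measurable_fst))

/-- The area formula applied to A ∩ (preimage of Y), restated for measures so that it extends to
integrals of real functions. -/
theorem IsC2Set.map_withDensity_normalMap [SFinite (boundaryMeasure E)] (hEo : IsOpen E)
    (hE : IsC2Set E) {A : Set (Euc d × ℝ)} (hA : MeasurableSet A) (hAW : A ⊆ strictContactSet E)
    (hfin : (boundaryMeasure E).prod volume A ≠ ∞) :
    ((((boundaryMeasure E).prod volume).restrict A).withDensity
      fun z => ENNReal.ofReal (normalDeriv E z).det).map (normalMap E) =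
      volume.restrict (normalMap E '' A) := by
  ext Y hY
  have hm := hE.measurable_normalMap hEo
  rw [Measure.map_apply hm hY, withDensity_apply _ (hm hY), Measure.restrict_restrict (hm hY),
    Measure.restrict_apply hY, ← hE.volume_image_eq hEo ((hm hY).inter hA)
      (inter_subset_right.trans hAW) (measure_ne_top_of_subset inter_subset_right hfin),
    image_preimage_inter]

theorem IsC2Set.aemeasurable_det [SFinite (boundaryMeasure E)] (hEo : IsOpen E)
    (hE : IsC2Set E) {A : Set (Euc d × ℝ)} (hA : MeasurableSet A) (hAW : A ⊆ strictContactSet E) :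
    AEMeasurable (fun z => (normalDeriv E z).det)
      (((boundaryMeasure E).prod volume).restrict A) := by
  have hc : ContinuousOn (fun z => (normalDeriv E z).det) A :=
    ContinuousLinearMap.continuous_det.comp_continuousOn ((hE.continuousOn_normalDeriv hEo).mono
      fun z hz => ⟨(strictContactSet_subset (hAW hz)).1, trivial⟩)
  exact hc.aemeasurable hA

theorem IsC2Set.integral_image_normalMap [SFinite (boundaryMeasure E)] (hEo : IsOpen E)
    (hE : IsC2Set E) {A : Set (Euc d × ℝ)} (hA : MeasurableSet A) (hAW : A ⊆ strictContactSet E)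
    (hfin : (boundaryMeasure E).prod volume A ≠ ∞) {k : Euc d → ℝ} (hk : Integrable k) :
    IntegrableOn (fun z => (normalDeriv E z).det * k (normalMap E z)) A
      ((boundaryMeasure E).prod volume) ∧
    ∫ y in normalMap E '' A, k y = ∫ z in A, (normalDeriv E z).det * k (normalMap E z)
      ∂(boundaryMeasure E).prod volume := by
  have hmap := hE.map_withDensity_normalMap hEo hA hAW hfin
  have hm := hE.measurable_normalMap hEo
  have hdet := (hE.aemeasurable_det hEo hA hAW).ennreal_ofReal
  have hlt : ∀ᵐ z ∂((boundaryMeasure E).prod volume).restrict A,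
      ENNReal.ofReal (normalDeriv E z).det < ∞ := Eventually.of_forall fun _ => ENNReal.ofReal_lt_top
  have hkr : Integrable k (volume.restrict (normalMap E '' A)) := hk.restrict
  have hks := hkr.aestronglyMeasurable
  rw [← hmap] at hks hkr
  have heq : (fun z => (ENNReal.ofReal (normalDeriv E z).det).toReal • k (normalMap E z))
      =ᵐ[((boundaryMeasure E).prod volume).restrict A]
      fun z => (normalDeriv E z).det * k (normalMap E z) := by
    filter_upwards [ae_restrict_mem hA] with z hz
    have h0 : 0 ≤ (normalDeriv E z).det := hE.det_nonneg hEo (strictContactSet_subset (hAW hz))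
    rw [ENNReal.toReal_ofReal h0, smul_eq_mul]
  constructor
  · rw [integrable_map_measure hks hm.aemeasurable,
      integrable_withDensity_iff_integrable_smul₀' hdet hlt] at hkr
    exact hkr.congr heq
  · rw [← hmap, integral_map hm.aemeasurable hks,
      integral_withDensity_eq_integral_toReal_smul₀ hdet hlt]
    exact integral_congr_ae heq

/-- Every point has normal coordinates in the contact set. The coordinates that are not strict, or
whose height lies in N, form a null set, and its image is null. -/
theorem IsC2Set.ae_exists_normalMap_eq [SFinite (boundaryMeasure E)] (hEo : IsOpen E)
    (hE : IsC2Set E) (hEb : Bornology.IsBounded E) (hne : (frontier E).Nonempty) {N : Set ℝ}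
    (hN : MeasurableSet N) (hN0 : volume N = 0) :
    ∀ᵐ y : Euc d, ∃ z ∈ strictContactSet E, z.2 ∉ N ∧ normalMap E z = y := by
  set B := (contactSet E \ strictContactSet E) ∪ (contactSet E ∩ univ ×ˢ N) with hB
  have hW := (hE.isClosed_contactSet hEo).measurableSet
  have hBm : MeasurableSet B := (hW.diff (hE.measurableSet_strictContactSet hEo)).union
    (hW.inter (MeasurableSet.univ.prod hN))
  have hB0 : (boundaryMeasure E).prod volume B = 0 := by
    refine measure_union_null (hE.measure_contactSet_diff hEo _)
      (measure_mono_null inter_subset_right ?_)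
    rw [Measure.prod_prod, hN0, mul_zero]
  have hBW : B ⊆ contactSet E := union_subset sdiff_subset inter_subset_left
  have h0 := hE.volume_image_eq_zero hEo hBm (fun z hz => ⟨(hBW hz).1, trivial⟩) hB0
  refine measure_mono_null ?_ h0
  intro y hy
  obtain ⟨z, hz, rfl⟩ := hE.exists_contact hEb hne y
  refine ⟨z, ?_, rfl⟩
  by_contra hc
  refine hy ⟨z, ?_, ?_, rfl⟩
  · by_contra h; exact hc (Or.inl ⟨hz, h⟩)
  · intro h; exact hc (Or.inr ⟨hz, trivial, h⟩)

end Transport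

/-! ### The profile, and the first variation under the integral sign. -/

section Profile

variable {f : ℝ → ℝ} {ρ₀ δ : ℝ}

theorem IsProfile.eventuallyEq_zero (hf : IsProfile f ρ₀ δ) {s : ℝ} (hs : ρ₀ < |s|) :
    f =ᶠ[𝓝 s] 0 := by
  rw [← notMem_tsupport_iff_eventuallyEq, hf.support]
  rintro ⟨h1, h2⟩
  exact (abs_le.2 ⟨h1, h2⟩).not_gt hs

theorem IsProfile.eq_zero (hf : IsProfile f ρ₀ δ) {s : ℝ} (hs : ρ₀ < s) : f s = 0 :=
  (hf.eventuallyEq_zero (hs.trans_le (le_abs_self s))).self_of_nhds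

theorem IsProfile.deriv_eq_zero (hf : IsProfile f ρ₀ δ) {s : ℝ} (hs : ρ₀ < |s|) :
    deriv f s = 0 := by
  rw [(hf.eventuallyEq_zero hs).deriv_eq]
  exact deriv_const s 0

theorem IsProfile.continuous (hf : IsProfile f ρ₀ δ) : Continuous f := by
  obtain ⟨K, hK⟩ := hf.lipschitz
  exact hK.continuous

theorem IsProfile.measurableSet_irregular (f : ℝ → ℝ) :
    MeasurableSet {s | s = 0 ∨ ¬DifferentiableAt ℝ f s} :=
  (measurableSet_singleton 0).union (measurableSet_of_differentiableAt ℝ f).compl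

theorem IsProfile.volume_irregular (hf : IsProfile f ρ₀ δ) :
    volume {s | s = 0 ∨ ¬DifferentiableAt ℝ f s} = 0 := by
  obtain ⟨K, hK⟩ := hf.lipschitz
  exact measure_union_null (Real.volume_singleton (a := 0)) hK.ae_differentiableAt_real

variable {d : ℕ} {E : Set (Euc d)} {φ : Euc d → ℝ}

theorem IsC2Set.measurableSet_regularSet (hEo : IsOpen E) (hE : IsC2Set E) (f : ℝ → ℝ) (ρ₀ : ℝ) :
    MeasurableSet (regularSet E f ρ₀) := by
  have h1 : MeasurableSet {z : Euc d × ℝ | |z.2| ≤ ρ₀} :=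
    (isClosed_le (by fun_prop) continuous_const).measurableSet
  have h2 := (IsProfile.measurableSet_irregular f).compl.preimage
    (measurable_snd : Measurable (Prod.snd : Euc d × ℝ → ℝ))
  have e : regularSet E f ρ₀ = strictContactSet E ∩ ({z | |z.2| ≤ ρ₀} ∩
      Prod.snd ⁻¹' {s | s = 0 ∨ ¬DifferentiableAt ℝ f s}ᶜ) := by
    ext z
    simp only [regularSet, mem_ofPred_eq, mem_inter_iff, mem_preimage, mem_compl_iff, not_or,
      not_not, ne_eq]
  rw [e]
  exact (hE.measurableSet_strictContactSet hEo).inter (h1.inter h2)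

theorem measure_regularSet_ne_top [IsFiniteMeasure (boundaryMeasure E)] (f : ℝ → ℝ) (ρ₀ : ℝ) :
    (boundaryMeasure E).prod volume (regularSet E f ρ₀) ≠ ∞ := by
  have hsub : regularSet E f ρ₀ ⊆ univ ×ˢ Icc (-ρ₀) ρ₀ :=
    fun z hz => ⟨trivial, abs_le.1 hz.2.1⟩
  refine measure_ne_top_of_subset hsub ?_
  rw [Measure.prod_prod, Real.volume_Icc]
  finiteness

/-- First variation of `∫ f (dist(y, ∂E)) dy` in normal coordinates. -/
theorem IsC2Set.hasDerivAt_integral_infDist (hEo : IsOpen E) (hE : IsC2Set E)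
    (hEb : Bornology.IsBounded E) (hne : (frontier E).Nonempty)
    (hφ : ContinuousOn φ (frontier E)) (hf : IsProfile f ρ₀ δ) :
    IntegrableOn (fun z : Euc d × ℝ => (normalDeriv E z).det * (-deriv f z.2 * φ z.1))
      (regularSet E f ρ₀) ((boundaryMeasure E).prod volume) ∧
    HasDerivAt (fun ε => ∫ y, f (infDist y (normalGraph E φ ε)))
      (∫ z in regularSet E f ρ₀, (normalDeriv E z).det * (-deriv f z.2 * φ z.1)
        ∂(boundaryMeasure E).prod volume) 0 := by
  have := hE.isFiniteMeasure_boundaryMeasure hEo hEb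
  have hcomp := isCompact_frontier_of_isBounded hEb
  obtain ⟨K, hK⟩ := hf.lipschitz
  obtain ⟨M, hM⟩ := hcomp.exists_bound_of_continuousOn hφ
  obtain ⟨x₀, hx₀⟩ := hne
  have hne : (frontier E).Nonempty := ⟨x₀, hx₀⟩
  have hM0 : 0 ≤ M := (norm_nonneg _).trans (hM x₀ hx₀)
  obtain ⟨R, hR⟩ := hcomp.isBounded.subset_closedBall (0 : Euc d)
  set S := closedBall (0 : Euc d) (R + (ρ₀ + M)) with hS
  set F : ℝ → Euc d → ℝ := fun ε y => f (infDist y (normalGraph E φ ε)) with hF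
  -- For |ε| < 1 the boundary moves by at most M, so a point farther than ρ₀ + M from ∂E stays
  -- beyond ρ₀ from every perturbation. All the integrands vanish off one fixed ball.
  have hF0 : ∀ ε ∈ ball (0 : ℝ) 1, ∀ y ∉ S, F ε y = 0 := by
    intro ε hε y hy
    refine hf.eq_zero ?_
    by_contra! hc
    have h1 := hE.infDist_normalGraph_le hEo hEb hne hφ hM y 0 ε
    rw [normalGraph_zero, zero_sub, abs_neg] at h1
    rw [mem_ball_zero_iff, Real.norm_eq_abs] at hε
    have h2 : M * |ε| ≤ M := mul_le_of_le_one_right hM0 hε.le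
    obtain ⟨w, hw, hwd⟩ := hcomp.exists_infDist_eq_dist hne y
    rw [hwd] at h1
    refine hy ?_
    rw [hS, mem_closedBall]
    have h3 := hR hw
    rw [mem_closedBall] at h3
    linarith [dist_triangle y w 0]
  have hlip : ∀ y ε ε', |F ε y - F ε' y| ≤ K * M * |ε - ε'| := by
    intro y ε ε'
    have h1 := hK.dist_le_mul (infDist y (normalGraph E φ ε)) (infDist y (normalGraph E φ ε'))
    rw [Real.dist_eq, Real.dist_eq] at h1
    refine h1.trans ?_
    rw [mul_assoc]
    exact mul_le_mul_of_nonneg_left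
      (hE.abs_infDist_normalGraph_sub_le hEo hEb hne hφ hM y ε ε') K.2
  have hmeas : ∀ ε, AEStronglyMeasurable (F ε) volume := fun ε =>
    (hf.continuous.comp (continuous_infDist_pt _)).aestronglyMeasurable
  have hae := hE.ae_exists_normalMap_eq hEo hEb hne (IsProfile.measurableSet_irregular f)
    hf.volume_irregular
  have hder : ∀ z ∈ strictContactSet E, z.2 ∉ {s | s = 0 ∨ ¬DifferentiableAt ℝ f s} →
      HasDerivAt (fun ε => F ε (normalMap E z)) (-deriv f z.2 * φ z.1) 0 := by
    rintro ⟨x, s⟩ hz hs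
    simp only [mem_ofPred_eq, not_or, not_not] at hs
    exact hE.hasDerivAt_comp_infDist hEo hEb hφ hf.even hz hs.1 hs.2
  have hdiff : ∀ᵐ y : Euc d, HasDerivAt (F · y) (deriv (F · y) 0) 0 := by
    filter_upwards [hae] with y hy
    obtain ⟨z, hz, hz2, rfl⟩ := hy
    exact (hder z hz hz2).differentiableAt.hasDerivAt
  -- The derivative in ε is measurable as an almost everywhere limit of difference quotients.
  have hF'meas : AEStronglyMeasurable (fun y => deriv (F · y) 0) volume := by
    refine aestronglyMeasurable_of_tendsto_ae (𝓝[≠] (0 : ℝ))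
      (f := fun t y => t⁻¹ • (F (0 + t) y - F 0 y)) ?_ ?_
    · exact fun t => ((hmeas (0 + t)).sub (hmeas 0)).const_smul t⁻¹
    · filter_upwards [hdiff] with y hy
      exact hy.tendsto_slope_zero
  have hF0int : Integrable (F 0) := by
    simp only [hF, normalGraph_zero]
    exact integrable_comp_infDist hf.continuous (fun s => hf.eq_zero) hcomp hne
  have hbound : Integrable (S.indicator fun _ => (K : ℝ) * M) :=
    (integrable_indicator_iff measurableSet_closedBall).2
      (integrableOn_const measure_closedBall_lt_top.ne)
  have hlip' : ∀ᵐ y : Euc d, LipschitzOnWith (Real.nnabs (S.indicator (fun _ => (K : ℝ) * M) y))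
      (F · y) (ball 0 1) := by
    refine Eventually.of_forall fun y => LipschitzOnWith.of_dist_le_mul fun ε hε ε' hε' => ?_
    rw [Real.dist_eq, Real.dist_eq, Real.coe_nnabs]
    have hKM : 0 ≤ (K : ℝ) * M := mul_nonneg K.2 hM0
    by_cases hy : y ∈ S
    · rw [indicator_of_mem hy, abs_of_nonneg hKM]
      exact hlip y ε ε'
    · rw [hF0 ε hε y hy, hF0 ε' hε' y hy]
      simp only [sub_self, abs_zero]
      positivity
  obtain ⟨hint, hD⟩ := hasDerivAt_integral_of_dominated_loc_of_lip (ball_mem_nhds (0 : ℝ) one_pos)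
    (Eventually.of_forall hmeas) hF0int hF'meas hlip' hbound hdiff
  have hA := hE.measurableSet_regularSet hEo f ρ₀
  have hAW : regularSet E f ρ₀ ⊆ strictContactSet E := fun z hz => hz.1
  obtain ⟨hI, hEq⟩ := hE.integral_image_normalMap hEo hA hAW (measure_regularSet_ne_top f ρ₀) hint
  have hcongr : ∀ z ∈ regularSet E f ρ₀,
      (normalDeriv E z).det * deriv (F · (normalMap E z)) 0 =
        (normalDeriv E z).det * (-deriv f z.2 * φ z.1) := by
    intro z hz
    rw [(hder z hz.1 (by simp [hz.2.2.1, hz.2.2.2])).deriv]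
  refine ⟨(integrableOn_congr_fun hcongr hA).1 hI, ?_⟩
  rw [← setIntegral_congr_fun hA hcongr, ← hEq]
  -- Almost every point outside the image of the regular set has |s| > ρ₀, where f' vanishes, so
  -- restricting the integral loses nothing.
  rw [setIntegral_eq_integral_of_ae_compl_eq_zero]
  · exact hD
  · filter_upwards [hae] with y hy hyA
    obtain ⟨z, hz, hz2, rfl⟩ := hy
    rw [(hder z hz hz2).deriv]
    have : ρ₀ < |z.2| := by
      by_contra! hc
      simp only [not_or, not_not] at hz2
      exact hyA ⟨z, ⟨hz, hc, hz2.1, hz2.2⟩, rfl⟩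
    rw [hf.deriv_eq_zero this, neg_zero, zero_mul]

end Profile

open Classical in
/-- The common density of the outer and inner curvatures, as a function of the signed distance. -/
noncomputable def signedDensity {d : ℕ} (f : ℝ → ℝ) (E : Set (Euc d)) (x : Euc d) (s : ℝ) : ℝ :=
  if (x, s) ∈ contactSet E then (normalDeriv E (x, s)).det * -deriv f s else 0

/-! ### The nonlocal curvature as a slice integral. -/

section Curvature

variable {d : ℕ} {E : Set (Euc d)} {f : ℝ → ℝ} {ρ₀ δ : ℝ} {φ : Euc d → ℝ} {x : Euc d}

theorem IsProfile.deriv_neg (hf : IsProfile f ρ₀ δ) (s : ℝ) : deriv f (-s) = -deriv f s := by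
  have e : f = fun t => f (-t) := funext fun t => (hf.even t).symm
  have h := deriv_comp_neg f s
  rw [← e] at h
  rw [h, neg_neg]

theorem IsProfile.pos (hf : IsProfile f ρ₀ δ) : 0 < ρ₀ := hf.delta_pos.trans hf.delta_lt

theorem IsProfile.intervalIntegrable_deriv (hf : IsProfile f ρ₀ δ) (a b : ℝ) :
    IntervalIntegrable (deriv f) volume a b := by
  obtain ⟨K, hK⟩ := hf.lipschitz
  exact (hK.lipschitzOnWith).absolutelyContinuousOnInterval.intervalIntegrable_deriv

theorem IsC2Set.intervalIntegrable_signedDensity (hEo : IsOpen E) (hE : IsC2Set E)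
    (hf : IsProfile f ρ₀ δ) (x : Euc d) (a b : ℝ) :
    IntervalIntegrable (signedDensity f E x) volume a b := by
  have hc : Continuous fun s : ℝ => (normalDeriv E (x, s)).det := by
    refine ContinuousLinearMap.continuous_det.comp ?_
    change Continuous fun s : ℝ => ContinuousLinearMap.id ℝ (Euc d) + s • gradNormal E x
    fun_prop
  have h1 : IntervalIntegrable (fun s => (normalDeriv E (x, s)).det * -deriv f s) volume a b :=
    (hf.intervalIntegrable_deriv a b).neg.continuousOn_mul hc.continuousOn
  have hm : MeasurableSet (Prod.mk x ⁻¹' contactSet E) :=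
    measurable_prodMk_left (hE.isClosed_contactSet hEo).measurableSet
  have e : signedDensity f E x = (Prod.mk x ⁻¹' contactSet E).indicator
      fun s => (normalDeriv E (x, s)).det * -deriv f s := by
    classical
    ext s
    simp only [signedDensity, indicator, mem_preimage]
  rw [e]
  rw [intervalIntegrable_iff] at h1 ⊢
  exact h1.indicator hm

theorem IsC2Set.curvPlus_eq (hE : IsC2Set E) (hx : x ∈ frontier E) {s : ℝ} (hs : 0 < s) :
    (-2 * s * deriv f s) * curvPlus s E x = signedDensity f E x s := by
  unfold curvPlus signedDensity
  by_cases hc : (x, s) ∈ contactSet E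
  · rw [if_pos ((hE.infDist_eq_iff_contact hx hs).2 hc), if_pos hc]
    simp only [normalDeriv]
    field_simp
  · rw [if_neg fun h => hc ((hE.infDist_eq_iff_contact hx hs).1 h), if_neg hc, mul_zero]

/-- The minus sign in κ⁻ is the oddness of f', so the inner curvature is the negative half of the
same signed density. -/
theorem IsC2Set.curvMinus_eq (hEo : IsOpen E) (hE : IsC2Set E) (hf : IsProfile f ρ₀ δ)
    (hx : x ∈ frontier E) {s : ℝ} (hs : 0 < s) :
    (-2 * s * deriv f s) * curvMinus s E x = signedDensity f E x (-s) := by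
  unfold curvMinus signedDensity
  by_cases hc : (x, -s) ∈ contactSet E
  · rw [if_pos ((hE.infDist_compl_eq_iff_contact hEo hx hs).2 hc), if_pos hc]
    have e : ContinuousLinearMap.id ℝ (Euc d) + -s • gradNormal E x =
        ContinuousLinearMap.id ℝ (Euc d) - s • gradNormal E x := by module
    simp only [normalDeriv, hf.deriv_neg, e]
    field_simp
  · rw [if_neg fun h => hc ((hE.infDist_compl_eq_iff_contact hEo hx hs).1 h), if_neg hc, mul_zero]

theorem IsC2Set.intervalIntegrable_curv (hEo : IsOpen E) (hE : IsC2Set E)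
    (hf : IsProfile f ρ₀ δ) (hx : x ∈ frontier E) :
    IntervalIntegrable (fun s => (-2 * s * deriv f s) * curvPlus s E x) volume 0 ρ₀ ∧
    IntervalIntegrable (fun s => (-2 * s * deriv f s) * curvMinus s E x) volume 0 ρ₀ := by
  have h1 := hE.intervalIntegrable_signedDensity hEo hf x 0 ρ₀
  have h2 : IntervalIntegrable (fun s => signedDensity f E x (-s)) volume 0 ρ₀ := by
    have := (IntervalIntegrable.iff_comp_neg (by simp)).1
      (hE.intervalIntegrable_signedDensity hEo hf x (-0) (-ρ₀))
    simpa using this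
  constructor
  · refine h1.congr fun s hs => ?_
    rw [uIoc_of_le hf.pos.le] at hs
    exact (hE.curvPlus_eq hx hs.1).symm
  · refine h2.congr fun s hs => ?_
    rw [uIoc_of_le hf.pos.le] at hs
    exact (hE.curvMinus_eq hEo hf hx hs.1).symm

theorem IsC2Set.curvSmoothed_eq (hEo : IsOpen E) (hE : IsC2Set E)
    (hf : IsProfile f ρ₀ δ) (hx : x ∈ frontier E) :
    curvSmoothed f ρ₀ E x = ∫ s in (-ρ₀)..ρ₀, signedDensity f E x s := by
  have h1 : ∫ s in (0 : ℝ)..ρ₀, (-2 * s * deriv f s) * curvPlus s E x =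
      ∫ s in (0 : ℝ)..ρ₀, signedDensity f E x s := by
    refine intervalIntegral.integral_congr_ae (Eventually.of_forall fun s hs => ?_)
    rw [uIoc_of_le hf.pos.le] at hs
    exact hE.curvPlus_eq hx hs.1
  have h2 : ∫ s in (0 : ℝ)..ρ₀, (-2 * s * deriv f s) * curvMinus s E x =
      ∫ s in (0 : ℝ)..ρ₀, signedDensity f E x (-s) := by
    refine intervalIntegral.integral_congr_ae (Eventually.of_forall fun s hs => ?_)
    rw [uIoc_of_le hf.pos.le] at hs
    exact hE.curvMinus_eq hEo hf hx hs.1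
  rw [curvSmoothed, h1, h2, intervalIntegral.integral_comp_neg, neg_zero, add_comm]
  exact intervalIntegral.integral_add_adjacent_intervals
    (hE.intervalIntegrable_signedDensity hEo hf x _ _)
    (hE.intervalIntegrable_signedDensity hEo hf x _ _)

/-- For almost every s with |s| ≤ ρ₀, regularity of (x,s) is equivalent to contact: the non-strict
heights, s = 0 and the points where f is not differentiable are negligible. -/
theorem IsC2Set.integral_slice_regularSet (hEo : IsOpen E) (hE : IsC2Set E)
    (hf : IsProfile f ρ₀ δ) (hx : x ∈ frontier E) :
    ∫ s, (regularSet E f ρ₀).indicator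
      (fun z : Euc d × ℝ => (normalDeriv E z).det * (-deriv f z.2 * φ z.1)) (x, s) =
      curvSmoothed f ρ₀ E x * φ x := by
  rw [hE.curvSmoothed_eq hEo hf hx, intervalIntegral.integral_of_le (by linarith [hf.pos]),
    ← integral_Icc_eq_integral_Ioc, ← integral_mul_const, ← integral_indicator measurableSet_Icc]
  refine integral_congr_ae ?_
  have h1 : ∀ᵐ s : ℝ, s ∉ Prod.mk x ⁻¹' (contactSet E \ strictContactSet E) :=
    measure_eq_zero_iff_ae_notMem.1 (volume_slice_contactSet_diff x)
  have h2 := measure_eq_zero_iff_ae_notMem.1 hf.volume_irregular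
  filter_upwards [h1, h2] with s h1 h2
  simp only [not_or, not_not] at h2
  simp only [mem_preimage, Set.mem_sdiff, not_and, not_not] at h1
  have hiff : (x, s) ∈ regularSet E f ρ₀ ↔ s ∈ Icc (-ρ₀) ρ₀ ∧ (x, s) ∈ contactSet E := by
    simp only [regularSet, mem_ofPred_eq, mem_Icc, ← abs_le]
    exact ⟨fun h => ⟨h.2.1, strictContactSet_subset h.1⟩, fun h => ⟨h1 h.2, h.1, h2.1, h2.2⟩⟩
  by_cases hs : s ∈ Icc (-ρ₀) ρ₀
  · rw [indicator_of_mem hs]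
    by_cases hc : (x, s) ∈ contactSet E
    · rw [indicator_of_mem (hiff.2 ⟨hs, hc⟩), signedDensity, if_pos hc, mul_assoc]
    · rw [indicator_of_notMem fun h => hc (hiff.1 h).2, signedDensity, if_neg hc, zero_mul]
  · rw [indicator_of_notMem hs, indicator_of_notMem fun h => hs (hiff.1 h).1]

theorem IsC2Set.integral_regularSet [IsFiniteMeasure (boundaryMeasure E)] (hEo : IsOpen E)
    (hE : IsC2Set E) (hf : IsProfile f ρ₀ δ)
    (hI : IntegrableOn (fun z : Euc d × ℝ => (normalDeriv E z).det * (-deriv f z.2 * φ z.1))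
      (regularSet E f ρ₀) ((boundaryMeasure E).prod volume)) :
    Integrable (fun x => curvSmoothed f ρ₀ E x * φ x) (boundaryMeasure E) ∧
    ∫ z in regularSet E f ρ₀, (normalDeriv E z).det * (-deriv f z.2 * φ z.1)
      ∂(boundaryMeasure E).prod volume =
      ∫ x, curvSmoothed f ρ₀ E x * φ x ∂boundaryMeasure E := by
  have hA := hE.measurableSet_regularSet hEo f ρ₀
  have hI' := (integrable_indicator_iff hA).2 hI
  have hae : ∀ᵐ x ∂boundaryMeasure E, ∫ s, (regularSet E f ρ₀).indicator
      (fun z : Euc d × ℝ => (normalDeriv E z).det * (-deriv f z.2 * φ z.1)) (x, s) =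
      curvSmoothed f ρ₀ E x * φ x := by
    filter_upwards [ae_restrict_mem isClosed_frontier.measurableSet] with x hx
    exact hE.integral_slice_regularSet hEo hf hx
  refine ⟨hI'.integral_prod_left.congr hae, ?_⟩
  rw [← integral_indicator hA, integral_prod _ hI']
  exact integral_congr_ae hae

end Curvature

/-! ### Essential oscillation of characteristic functions on balls. -/

section Oscillation

variable {d : ℕ} {F : Set (Euc d)} {x : Euc d} {s : ℝ}

theorem essOsc_of_eqOn_const {A : Set (Euc d)} (hA : MeasurableSet A) (hA0 : volume A ≠ 0)
    {u : Euc d → ℝ} {c : ℝ} (hu : ∀ y ∈ A, u y = c) : essOsc A u = 0 := by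
  have h : u =ᵐ[volume.restrict A] fun _ => c := by
    filter_upwards [ae_restrict_mem hA] with y hy using hu y hy
  have h0 : volume.restrict A ≠ 0 := by rwa [Ne, Measure.restrict_eq_zero]
  rw [essOsc, essSup_congr_ae h, essInf_congr_ae h, essSup_const _ h0, essInf_const _ h0, sub_self]

theorem essOsc_indicator_eq_one {A : Set (Euc d)} (h1 : (volume.restrict A) F ≠ 0)
    (h0 : (volume.restrict A) Fᶜ ≠ 0) : essOsc A (F.indicator fun _ => (1 : ℝ)) = 1 := by
  have e1 : essSup (F.indicator fun _ => (1 : ℝ)) (volume.restrict A) = 1 := by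
    rw [essSup_eq_sInf]
    have : {a : ℝ | (volume.restrict A) {y | a < F.indicator (fun _ => (1 : ℝ)) y} = 0} =
        Ici 1 := by
      ext a
      simp only [mem_ofPred_eq, mem_Ici]
      constructor
      · intro ha
        by_contra! hlt
        refine h1 (measure_mono_null (fun y hy => ?_) ha)
        rw [mem_ofPred_eq, indicator_of_mem hy]
        exact hlt
      · intro ha
        convert measure_empty (μ := volume.restrict A)
        ext y
        simp only [mem_ofPred_eq, mem_empty_iff_false, iff_false, not_lt]
        exact (indicator_le_self' (fun _ _ => zero_le_one) y).trans ha
    rw [this, csInf_Ici]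
  have e0 : essInf (F.indicator fun _ => (1 : ℝ)) (volume.restrict A) = 0 := by
    rw [essInf_eq_sSup]
    have : {a : ℝ | (volume.restrict A) {y | F.indicator (fun _ => (1 : ℝ)) y < a} = 0} =
        Iic 0 := by
      ext a
      simp only [mem_ofPred_eq, mem_Iic]
      constructor
      · intro ha
        by_contra! hlt
        refine h0 (measure_mono_null (fun y hy => ?_) ha)
        rw [mem_ofPred_eq, indicator_of_notMem hy]
        exact hlt
      · intro ha
        convert measure_empty (μ := volume.restrict A)
        ext y
        simp only [mem_ofPred_eq, mem_empty_iff_false, iff_false, not_lt]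
        exact ha.trans (indicator_nonneg (fun _ _ => zero_le_one) y)
    rw [this, csSup_Iic]
  rw [essOsc, e1, e0, sub_zero]

/-- A ball meeting the frontier contains nonempty open pieces of F and of the interior of the
complement, both of positive measure. A ball missing it lies on one side, by convexity. The closure
condition rules out slits, which almost everywhere quantities do not see. -/
theorem essOsc_ball_indicator (hFo : IsOpen F) (hF : frontier F ⊆ closure (interior Fᶜ))
    (hne : (frontier F).Nonempty) (hs : 0 < s) :
    ENNReal.ofReal (essOsc (ball x s) (F.indicator fun _ => (1 : ℝ))) =
      {y | infDist y (frontier F) < s}.indicator 1 x := by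
  have hb0 : volume (ball x s) ≠ 0 := (measure_ball_pos volume x hs).ne'
  have hiff : infDist x (frontier F) < s ↔ (frontier F ∩ ball x s).Nonempty := by
    rw [infDist_lt_iff hne]
    exact ⟨fun ⟨y, hy, hd⟩ => ⟨y, hy, by rwa [mem_ball, dist_comm]⟩,
      fun ⟨y, hy, hd⟩ => ⟨y, hy, by rwa [mem_ball, dist_comm] at hd⟩⟩
  by_cases hm : (frontier F ∩ ball x s).Nonempty
  · rw [indicator_of_mem (show x ∈ {y | infDist y (frontier F) < s} from hiff.2 hm),
      essOsc_indicator_eq_one, ENNReal.ofReal_one, Pi.one_apply]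
    · obtain ⟨y, hy, hyb⟩ := hm
      rw [Measure.restrict_apply hFo.measurableSet]
      refine ((hFo.inter isOpen_ball).measure_pos volume ?_).ne'
      have := mem_closure_iff.1 (frontier_subset_closure hy) _ isOpen_ball hyb
      rwa [inter_comm]
    · obtain ⟨y, hy, hyb⟩ := hm
      rw [Measure.restrict_apply hFo.measurableSet.compl]
      have h1 : (interior Fᶜ ∩ ball x s).Nonempty := by
        have := mem_closure_iff.1 (hF hy) _ isOpen_ball hyb
        rwa [inter_comm]
      exact (((isOpen_interior.inter isOpen_ball).measure_pos volume h1).trans_le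
        (measure_mono (inter_subset_inter_left _ interior_subset))).ne'
  · rw [indicator_of_notMem (show x ∉ {y | infDist y (frontier F) < s} from fun h => hm (hiff.1 h))]
    by_cases hd : ∃ a ∈ ball x s, a ∈ F
    · have hsub : ∀ b ∈ ball x s, b ∈ F := by
        intro b hb
        by_contra hbF
        obtain ⟨a, ha, haF⟩ := hd
        obtain ⟨c, hc, hcf⟩ := exists_mem_segment_frontier haF hbF
        exact hm ⟨c, hcf, (convex_ball x s).segment_subset ha hb hc⟩
      rw [essOsc_of_eqOn_const (c := 1) measurableSet_ball hb0 fun y hy =>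
        indicator_of_mem (hsub y hy) _, ENNReal.ofReal_zero]
    · push Not at hd
      rw [essOsc_of_eqOn_const (c := 0) measurableSet_ball hb0 fun y hy =>
        indicator_of_notMem (hd y hy) _, ENNReal.ofReal_zero]

end Oscillation

/-! ### The smoothed energy as an integral of the distance function. -/

section Energy

variable {d : ℕ} {F : Set (Euc d)} {f : ℝ → ℝ} {ρ₀ δ : ℝ}

theorem IsProfile.deriv_nonpos (hf : IsProfile f ρ₀ δ) {s : ℝ} (hs : 0 < s) : deriv f s ≤ 0 := by
  rw [← derivWithin_of_mem_nhds (Ici_mem_nhds hs)]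
  exact hf.antitone.derivWithin_nonpos

theorem IsProfile.apply_radius (hf : IsProfile f ρ₀ δ) : f ρ₀ = 0 := by
  have h : Tendsto f (𝓝[>] ρ₀) (𝓝 (f ρ₀)) := (hf.continuous.tendsto ρ₀).mono_left nhdsWithin_le_nhds
  refine tendsto_nhds_unique h (tendsto_const_nhds.congr' ?_)
  filter_upwards [self_mem_nhdsWithin] with s hs using (hf.eq_zero hs).symm

/-- The fundamental theorem of calculus for a Lipschitz function, from D to ρ₀, where f vanishes;
beyond ρ₀ both sides are 0. -/
theorem IsProfile.lintegral_deriv (hf : IsProfile f ρ₀ δ) {D : ℝ} (hD : 0 ≤ D) :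
    ∫⁻ s in Ioc 0 ρ₀, (ENNReal.ofReal (-deriv f s) * (Ioi D).indicator 1 s) =
      ENNReal.ofReal (f D) := by
  have e : ∀ s, ENNReal.ofReal (-deriv f s) * (Ioi D).indicator 1 s =
      (Ioi D).indicator (fun s => ENNReal.ofReal (-deriv f s)) s := by
    intro s
    by_cases h : s ∈ Ioi D
    · rw [indicator_of_mem h, indicator_of_mem h, Pi.one_apply, mul_one]
    · rw [indicator_of_notMem h, indicator_of_notMem h, mul_zero]
  simp only [e]
  have e2 : Ioi D ∩ Ioc 0 ρ₀ = Ioc D ρ₀ := by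
    ext s
    simp only [mem_inter_iff, mem_Ioi, mem_Ioc]
    exact ⟨fun h => ⟨h.1, h.2.2⟩, fun h => ⟨h.1, hD.trans_lt h.1, h.2⟩⟩
  rw [lintegral_indicator measurableSet_Ioi, Measure.restrict_restrict measurableSet_Ioi, e2]
  rcases le_or_gt D ρ₀ with hle | hlt
  · have hint : IntegrableOn (fun s => -deriv f s) (Ioc D ρ₀) :=
      ((intervalIntegrable_iff_integrableOn_Ioc_of_le hle).1
        (hf.intervalIntegrable_deriv D ρ₀)).neg
    rw [← ofReal_integral_eq_lintegral_ofReal hint]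
    · obtain ⟨K, hK⟩ := hf.lipschitz
      rw [integral_neg, ← intervalIntegral.integral_of_le hle,
        (hK.lipschitzOnWith).absolutelyContinuousOnInterval.integral_deriv_eq_sub,
        hf.apply_radius, zero_sub, neg_neg]
    · filter_upwards [ae_restrict_mem measurableSet_Ioc] with s hs
      have := hf.deriv_nonpos (hD.trans_lt hs.1)
      simpa using this
  · rw [Ioc_eq_empty hlt.not_gt, Measure.restrict_empty, lintegral_zero_measure, hf.eq_zero hlt,
      ENNReal.ofReal_zero]

/-- Layer cake formula for the smoothed energy. -/
theorem smoothedEnergy_eq (hf : IsProfile f ρ₀ δ) (hFo : IsOpen F)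
    (hF : frontier F ⊆ closure (interior Fᶜ)) (hne : (frontier F).Nonempty) :
    smoothedEnergy f ρ₀ F = ∫⁻ y, ENNReal.ofReal (f (infDist y (frontier F))) := by
  have h1 : ∀ s ∈ Ioc 0 ρ₀, ENNReal.ofReal (-2 * s * deriv f s) * energyAt s F =
      ∫⁻ y, ENNReal.ofReal (-deriv f s) * {y | infDist y (frontier F) < s}.indicator 1 y := by
    intro s hs
    have hs0 : 0 < s := hs.1
    have hm : MeasurableSet {y | infDist y (frontier F) < s} :=
      (isOpen_lt (continuous_infDist_pt _) continuous_const).measurableSet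
    simp only [energyAt, essOsc_ball_indicator hFo hF hne hs0]
    rw [lintegral_const_mul _ (measurable_one.indicator hm), ← mul_assoc,
      ← ENNReal.ofReal_mul' (by positivity)]
    congr 2
    field_simp
  -- By Tonelli, for fixed y the weight -f' is integrated over s > dist(y, ∂F), which returns f at
  -- that distance.
  rw [smoothedEnergy, setLIntegral_congr_fun measurableSet_Ioc h1, lintegral_lintegral_swap]
  · refine lintegral_congr fun y => ?_
    rw [← hf.lintegral_deriv infDist_nonneg]
    rfl
  · have hm : MeasurableSet {p : ℝ × Euc d | infDist p.2 (frontier F) < p.1} :=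
      (isOpen_lt ((continuous_infDist_pt _).comp continuous_snd) continuous_fst).measurableSet
    have := (((measurable_deriv f).neg.ennreal_ofReal).comp
      (measurable_fst : Measurable (Prod.fst : ℝ × Euc d → ℝ))).mul
      ((measurable_one (α := ℝ≥0∞)).indicator hm)
    exact this.aemeasurable

theorem smoothedEnergy_empty (f : ℝ → ℝ) (ρ₀ : ℝ) :
    smoothedEnergy f ρ₀ (∅ : Set (Euc d)) = 0 := by
  rw [smoothedEnergy, setLIntegral_congr_fun (g := fun _ => 0) measurableSet_Ioc]
  · simp
  · intro s hs
    have hs0 : 0 < s := hs.1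
    have : ∀ x : Euc d, essOsc (ball x s) ((∅ : Set (Euc d)).indicator fun _ => (1 : ℝ)) = 0 :=
      fun x => essOsc_of_eqOn_const (c := 0) measurableSet_ball
        (measure_ball_pos volume x hs0).ne' (by simp)
    simp only [energyAt, this, ENNReal.ofReal_zero, lintegral_zero, mul_zero]

variable {E : Set (Euc d)}

/-- The conditions needed for the distance formula are purely topological, so a homeomorphism
carries them from E to its image; the image need not be of class C². -/
theorem IsC2Set.smoothedEnergy_image (hEo : IsOpen E) (hE : IsC2Set E)
    (hne : (frontier E).Nonempty) (hf : IsProfile f ρ₀ δ) (e : Euc d ≃ₜ Euc d) :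
    smoothedEnergy f ρ₀ (e '' E) =
      ∫⁻ y, ENNReal.ofReal (f (infDist y (e '' frontier E))) := by
  rw [smoothedEnergy_eq hf (e.isOpenMap E hEo), ← e.image_frontier]
  · rw [← e.image_frontier, ← image_compl_eq e.bijective, ← e.image_interior, ← e.image_closure]
    exact image_mono hE.frontier_subset_closure_interior_compl
  · rw [← e.image_frontier]
    exact hne.image e

theorem integrable_and_toReal_lintegral (hf : IsProfile f ρ₀ δ) {K : Set (Euc d)}
    (hK : IsCompact K) (hne : K.Nonempty) :
    ∫⁻ y, ENNReal.ofReal (f (infDist y K)) ≠ ∞ ∧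
      (∫⁻ y, ENNReal.ofReal (f (infDist y K))).toReal = ∫ y, f (infDist y K) := by
  have hi := integrable_comp_infDist hf.continuous (fun s => hf.eq_zero) hK hne
  rw [← ofReal_integral_eq_lintegral_ofReal hi (Eventually.of_forall fun y => hf.nonneg _)]
  exact ⟨ENNReal.ofReal_ne_top, ENNReal.toReal_ofReal (integral_nonneg fun y => hf.nonneg _)⟩

theorem eq_empty_of_frontier_eq_empty (hd : 1 ≤ d) (hEb : Bornology.IsBounded E)
    (h : frontier E = ∅) : E = ∅ := by
  have : Nonempty (Fin d) := ⟨⟨0, hd⟩⟩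
  rcases isClopen_iff.1 (isClopen_iff_frontier_eq_empty.2 h) with h | h
  · exact h
  · rw [h] at hEb
    exact absurd hEb (NormedSpace.unbounded_univ ℝ (Euc d))

end Energy

/-! ### Conclusion: the first variation of the smoothed energy. -/

theorem mainTheorem5 {d : ℕ} (hd : 1 ≤ d) {f : ℝ → ℝ} {ρ₀ δ : ℝ} (hf : IsProfile f ρ₀ δ)
    {E : Set (Euc d)} (hEo : IsOpen E) (hEb : Bornology.IsBounded E) (hE : IsC2Set E)
    {φ : Euc d → ℝ} (hφ : IsC2OnFrontier E φ)
    (Φ : ℝ → Diffeomorph 𝓘(ℝ, Euc d) 𝓘(ℝ, Euc d) (Euc d) (Euc d) 1)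
    (hΦ : ∀ᶠ ε in 𝓝 (0 : ℝ), ∀ x ∈ frontier E, Φ ε x = x + (ε * φ x) • outerNormal E x) :
    (∀ x ∈ frontier E,
      IntervalIntegrable (fun s => (-2 * s * deriv f s) * curvPlus s E x) volume 0 ρ₀ ∧
      IntervalIntegrable (fun s => (-2 * s * deriv f s) * curvMinus s E x) volume 0 ρ₀) ∧
    IntegrableOn (fun x => curvSmoothed f ρ₀ E x * φ x) (frontier E)
      (Measure.euclideanHausdorffMeasure (d - 1)) ∧
    (∀ ε, smoothedEnergy f ρ₀ (Φ ε '' E) ≠ ∞) ∧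
    HasDerivAt (fun ε => (smoothedEnergy f ρ₀ (Φ ε '' E)).toReal)
      (∫ x in frontier E, curvSmoothed f ρ₀ E x * φ x ∂(Measure.euclideanHausdorffMeasure (d - 1)))
      0 := by
  refine ⟨fun x hx => hE.intervalIntegrable_curv hEo hf hx, ?_⟩
  -- The empty boundary is treated apart because `infDist` to the empty set is 0 by convention, so
  -- the distance formula for the energy would be false there.
  rcases (frontier E).eq_empty_or_nonempty with h0 | hne
  · have hE0 := eq_empty_of_frontier_eq_empty hd hEb h0
    subst hE0
    simp only [h0, image_empty, smoothedEnergy_empty, integrableOn_empty, setIntegral_empty,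
      ENNReal.toReal_zero]
    exact ⟨trivial, fun _ => ENNReal.zero_ne_top, hasDerivAt_const _ _⟩
  have := hE.isFiniteMeasure_boundaryMeasure hEo hEb
  have hcomp := isCompact_frontier_of_isBounded hEb
  obtain ⟨hI, hD⟩ := hE.hasDerivAt_integral_infDist hEo hEb hne hφ.continuousOn hf
  obtain ⟨hI', hEq⟩ := hE.integral_regularSet hEo hf hI
  have henergy : ∀ ε, smoothedEnergy f ρ₀ (Φ ε '' E) ≠ ∞ ∧
      (smoothedEnergy f ρ₀ (Φ ε '' E)).toReal =
        ∫ y, f (infDist y (Φ ε '' frontier E)) := by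
    intro ε
    have h1 := hE.smoothedEnergy_image hEo hne hf (Φ ε).toHomeomorph
    rw [Diffeomorph.coe_toHomeomorph] at h1
    rw [h1]
    exact integrable_and_toReal_lintegral hf (hcomp.image (Φ ε).continuous) (hne.image _)
  refine ⟨hI', fun ε => (henergy ε).1, ?_⟩
  rw [hEq] at hD
  -- The energies see Φ_ε only through the image of ∂E, which is the normal graph of εφ for all
  -- small ε.
  refine hD.congr_of_eventuallyEq ?_
  filter_upwards [hΦ] with ε hε
  rw [(henergy ε).2, normalGraph, image_congr hε]
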